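/- Let $r>0$. Let $\mathcal{WL}_r$ be the set of pairs $(W,f)$ with $W:[0,1]^2\to[0,1]$ measurable and symmetric and $f:[0,1]\to[-r,r]$ measurable. Put $\|W\|_\square=\sup_{S,T}|\int_{S\times T}W|$ and $\|f\|_\square=\sup_S|\int_S f|$, with suprema over measurable $S,T\subseteq[0,1]$, and $$\delta_\square\big((W,f),(V,g)\big)=\inf_{\phi}\big(\|W-V^\phi\|_\square+\|f-g^\phi\|_\square\big),\qquad V^\phi(x,y)=V(\phi(x),\phi(y)),\quad g^\phi=g\circ\phi,$$ where $\phi$ ranges over the measure preserving measurable bijections between co-null subsets of $[0,1]$. Let $\widetilde{\mathcal{WL}_r}$ be the metric space obtained from $\mathcal{WL}_r$ by identifying points at $\delta_\square$-distance $0$, with its Borel $\sigma$-algebra. All spaces $\mathbb R^m$ carry the norm $\|\cdot\|_\infty$. Let $a>2$ and $k(\epsilon)=\lceil 2^{a/\epsilon^2}\rceil$. There is $\epsilon_0>0$, depending only on $r$ and $a$, such that $\widetilde{\mathcal{WL}_r}$ is covered by $2^{k(\epsilon)^2}$ balls of radius $\epsilon$ for every $0<\epsilon\le\epsilon_0$,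 and such that the following holds. Let $C\ge 1$, $N\ge1$, $L_1>0$, $L_2\ge 0$, $p>0$, and $L=L_1L_2$. Let $\nu$ be any Borel probability measure on $\widetilde{\mathcal{WL}_r}$. Let $\mathcal C:\widetilde{\mathcal{WL}_r}\to\{0,1\}^C$ be a classifier: there is a partition of $\widetilde{\mathcal{WL}_r}$ into Borel sets $B_1,\dots,B_C$ such that $\mathcal C$ equals the $i$-th standard basis vector $e_i$ on $B_i$. Put $\epsilon_1=\epsilon_0\min\{1,L_1\}$; let $\kappa(\epsilon)=2^{k(\epsilon)^2}$ for $0<\epsilon\le\epsilon_1$ and $\kappa(\epsilon)=\kappa(\epsilon_1)$ for $\epsilon>\epsilon_1$; let $\xi(\epsilon)=\kappa(\epsilon)^2\log\kappa(\epsilon)/\epsilon^2$, a strictly decreasing function on $(0,\infty)$, and let $\xi^{-1}(y)=\inf\{\epsilon>0:\xi(\epsilon)\le y\}$ be its (generalized) inverse. Then there is a measurable event $\mathcal U^p\subseteq\widetilde{\mathcal{WL}_r}^N$ with $$\nu^N(\mathcal U^p)\ \ge\ 1-Cp-\frac{2C^2}{N}$$ such that for every $\mathbf X=(X_1,\dots,X_N)\in\mathcal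 U^p$, every $L_2$-Lipschitz loss $\mathcal E:\mathbb R^C\times\mathbb R^C\to\mathbb R$ and every $L_1$-Lipschitz $\Upsilon:\widetilde{\mathcal{WL}_r}\to\mathbb R^C$ (both may depend on $\mathbf X$), $$\Big|\int\mathcal E(\Upsilon(x),\mathcal C(x))\,d\nu(x)-\frac1N\sum_{i=1}^N\mathcal E(\Upsilon(X_i),\mathcal C(X_i))\Big|\le \xi^{-1}\!\Big(\frac{N}{2C}\Big)\Big(2L+\frac1{\sqrt2}\big(L+|\mathcal E(0,0)|\big)\big(1+\sqrt{\log(2/p)}\big)\Big),$$ where $\sqrt{\log(2/p)}$ is read as $0$ if $p>2$ (in which case the probability bound is trivial). -/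

import Mathlib

namespace GraphonSignals

noncomputable section

open MeasureTheory Set
open scoped unitInterval NNReal

/-! ### Graphon-signals and cut norms -/

/-- A graphon-signal: a graphon `W`, i.e. a symmetric measurable kernel `[0,1]² → [0,1]`, together
with a measurable signal `f : [0,1] → [-r, r]`. -/
structure GraphonSignal (r : ℝ) where
  W : I → I → ℝ
  f : I → ℝ
  measurable_W : Measurable (fun z : I × I => W z.1 z.2)
  symm_W : ∀ x y, W x y = W y x
  W_mem : ∀ x y, W x y ∈ Icc (0 : ℝ) 1
  measurable_f : Measurable f
  abs_f_le : ∀ x, |f x| ≤ r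

/-- The cut norm of a kernel: the supremum of `|∫_{S × T} W|` over measurable `S, T ⊆ [0,1]`. -/
def kernelCutNorm (W : I → I → ℝ) : ℝ :=
  ⨆ P : {S : Set I // MeasurableSet S} × {T : Set I // MeasurableSet T},
    |∫ z in (P.1 : Set I) ×ˢ (P.2 : Set I), W z.1 z.2|

/-- The cut norm of a signal: the supremum of `|∫_S f|` over measurable `S ⊆ [0,1]`. -/
def signalCutNorm (f : I → ℝ) : ℝ :=
  ⨆ S : {S : Set I // MeasurableSet S}, |∫ x in (S : Set I), f x|

/-- Measurable measure preserving bijections `dom → cod` between co-null subsets of `[0,1]`. The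
map is extended measurably to all of `[0,1]`; its values off `dom` (a null set) are irrelevant. -/
structure ConullBijection where
  toFun : I → I
  dom : Set I
  cod : Set I
  measurable_toFun : Measurable toFun
  measurableSet_dom : MeasurableSet dom
  measurableSet_cod : MeasurableSet cod
  conull_dom : volume domᶜ = 0
  conull_cod : volume codᶜ = 0
  bijOn : BijOn toFun dom cod
  measure_image : ∀ S ⊆ dom, MeasurableSet S → volume (toFun '' S) = volume S

/-- The graphon-signal cut metric `d_□((W, f), (V, g)) = ‖W - V‖_□ + ‖f - g‖_□`. -/
def cutMetric (W : I → I → ℝ) (f : I → ℝ) (V : I → I → ℝ) (g : I → ℝ) : ℝ :=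
  kernelCutNorm (fun x y => W x y - V x y) + signalCutNorm (fun x => f x - g x)

/-- The graphon-signal cut distance `δ_□((W, f), (V, g)) = inf_φ d_□((W, f), (V, g)^φ)`. -/
def cutDist {r : ℝ} (u v : GraphonSignal r) : ℝ :=
  ⨅ φ : ConullBijection,
    cutMetric u.W u.f (fun x y => v.W (φ.toFun x) (φ.toFun y)) (fun x => v.f (φ.toFun x))

/-! ### The cut distance is a pseudometric -/

section Aux

variable {Ω ι : Type*} [MeasurableSpace Ω]

/-- Supremum of `|∫_S F|` over an indexed family of sets. -/
def supInt (μ : Measure Ω) (s : ι → Set Ω) (F : Ω → ℝ) : ℝ :=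
  ⨆ i, |∫ z in s i, F z ∂μ|

/-- Bounded measurable functions. -/
def BM (F : Ω → ℝ) : Prop := Measurable F ∧ ∃ M, ∀ z, |F z| ≤ M

lemma BM.integrable {F : Ω → ℝ} (h : BM F) (μ : Measure Ω) [IsFiniteMeasure μ] :
    Integrable F μ := by
  obtain ⟨hm, M, hM⟩ := h
  exact Integrable.of_bound hm.aestronglyMeasurable M (Filter.Eventually.of_forall hM)

lemma BM.sub {F G : Ω → ℝ} (hF : BM F) (hG : BM G) : BM (fun z => F z - G z) := by
  obtain ⟨hm, M, hM⟩ := hF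
  obtain ⟨hm', M', hM'⟩ := hG
  exact ⟨hm.sub hm', M + M', fun z => (abs_sub _ _).trans (add_le_add (hM z) (hM' z))⟩

lemma BM.comp {Ω' : Type*} [MeasurableSpace Ω'] {F : Ω → ℝ} (hF : BM F) {g : Ω' → Ω}
    (hg : Measurable g) : BM (fun z => F (g z)) :=
  ⟨hF.1.comp hg, hF.2.imp fun _ h z => h (g z)⟩

lemma supInt_nonneg (μ : Measure Ω) (s : ι → Set Ω) (F : Ω → ℝ) : 0 ≤ supInt μ s F :=
  Real.iSup_nonneg fun _ => abs_nonneg _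

lemma bdd_supInt (μ : Measure Ω) [IsFiniteMeasure μ] (s : ι → Set Ω) {F : Ω → ℝ}
    (hF : BM F) : BddAbove (range fun i => |∫ z in s i, F z ∂μ|) := by
  refine ⟨∫ z, |F z| ∂μ, ?_⟩
  rintro _ ⟨i, rfl⟩
  refine (abs_integral_le_integral_abs).trans ?_
  exact setIntegral_le_integral (hF.integrable μ).abs (Filter.Eventually.of_forall fun _ => abs_nonneg _)

lemma supInt_add_le (μ : Measure Ω) [IsFiniteMeasure μ] (s : ι → Set Ω) {F G H : Ω → ℝ}
    (hF : BM F) (hG : BM G) (h : ∀ z, H z = F z + G z) :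
    supInt μ s H ≤ supInt μ s F + supInt μ s G := by
  refine Real.iSup_le (fun i => ?_) (add_nonneg (supInt_nonneg _ _ _) (supInt_nonneg _ _ _))
  have : ∫ z in s i, H z ∂μ = ∫ z in s i, F z ∂μ + ∫ z in s i, G z ∂μ := by
    rw [← integral_add (hF.integrable _) (hG.integrable _)]
    simp only [h]
  rw [this]
  exact (abs_add_le _ _).trans
    (add_le_add (le_ciSup (bdd_supInt μ s hF) i) (le_ciSup (bdd_supInt μ s hG) i))

lemma supInt_neg (μ : Measure Ω) (s : ι → Set Ω) {F G : Ω → ℝ} (h : ∀ z, G z = - F z) :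
    supInt μ s G = supInt μ s F := by
  unfold supInt
  simp only [h, integral_neg, abs_neg]

lemma supInt_congr {μ : Measure Ω} (s : ι → Set Ω) {F G : Ω → ℝ} (h : F =ᵐ[μ] G) :
    supInt μ s F = supInt μ s G := by
  unfold supInt
  congr 1
  funext i
  rw [integral_congr_ae (ae_restrict_of_ae h)]

lemma supInt_comp_le {μ : Measure Ω} [IsFiniteMeasure μ] (s : ι → Set Ω) {F : Ω → ℝ}
    (hF : BM F) {g : Ω → Ω} (hg : MeasurePreserving g μ μ)
    (hs : ∀ i, ∃ j, MeasurableSet (s j) ∧ s i =ᵐ[μ] g ⁻¹' (s j)) :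
    supInt μ s (fun z => F (g z)) ≤ supInt μ s F := by
  refine Real.iSup_le (fun i => ?_) (supInt_nonneg _ _ _)
  obtain ⟨j, hj, hij⟩ := hs i
  have : ∫ z in s i, F (g z) ∂μ = ∫ z in s j, F z ∂μ := by
    rw [setIntegral_congr_set hij]
    conv_rhs => rw [← hg.map_eq]
    rw [setIntegral_map hj hF.1.aestronglyMeasurable hg.measurable.aemeasurable]
  rw [this]
  exact le_ciSup (bdd_supInt μ s hF) j

end Aux

namespace ConullBijection

lemma ae_dom (φ : ConullBijection) : ∀ᵐ x, x ∈ φ.dom := φ.conull_dom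

lemma ae_cod (φ : ConullBijection) : ∀ᵐ x, x ∈ φ.cod := φ.conull_cod

lemma measurePreserving (φ : ConullBijection) :
    MeasurePreserving φ.toFun volume volume := by
  refine ⟨φ.measurable_toFun, ?_⟩
  ext S hS
  rw [Measure.map_apply φ.measurable_toFun hS]
  have h1 : volume (φ.toFun ⁻¹' S) = volume (φ.toFun ⁻¹' S ∩ φ.dom) := by
    refine measure_congr ?_
    filter_upwards [φ.ae_dom] with x hx
    exact propext ⟨fun h => ⟨h, hx⟩, fun h => h.1⟩
  have h2 : volume S = volume (S ∩ φ.cod) := by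
    refine measure_congr ?_
    filter_upwards [φ.ae_cod] with x hx
    exact propext ⟨fun h => ⟨h, hx⟩, fun h => h.1⟩
  rw [h1, h2, ← φ.measure_image _ inter_subset_right
    ((φ.measurable_toFun hS).inter φ.measurableSet_dom)]
  congr 1
  ext y
  constructor
  · rintro ⟨x, ⟨hx, hxd⟩, rfl⟩
    exact ⟨hx, φ.bijOn.mapsTo hxd⟩
  · rintro ⟨hy, hyc⟩
    obtain ⟨x, hxd, rfl⟩ := φ.bijOn.surjOn hyc
    exact ⟨x, ⟨hy, hxd⟩, rfl⟩

lemma measurableSet_image (φ : ConullBijection) {S : Set I} (hS : MeasurableSet S) :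
    MeasurableSet (φ.toFun '' (S ∩ φ.dom)) :=
  (hS.inter φ.measurableSet_dom).image_of_measurable_injOn φ.measurable_toFun
    (φ.bijOn.injOn.mono inter_subset_right)

lemma ae_eq_preimage (φ : ConullBijection) (S : Set I) :
    S =ᵐ[volume] φ.toFun ⁻¹' (φ.toFun '' (S ∩ φ.dom)) := by
  filter_upwards [φ.ae_dom] with x hx
  refine propext ⟨fun h => ⟨x, ⟨h, hx⟩, rfl⟩, ?_⟩
  rintro ⟨y, ⟨hy, hyd⟩, hxy⟩
  rwa [φ.bijOn.injOn hyd hx hxy] at hy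

/-- The identity. -/
protected def refl : ConullBijection where
  toFun := id
  dom := univ
  cod := univ
  measurable_toFun := measurable_id
  measurableSet_dom := .univ
  measurableSet_cod := .univ
  conull_dom := by simp
  conull_cod := by simp
  bijOn := bijOn_id _
  measure_image := by simp

/-- Composition. -/
protected def trans (φ ψ : ConullBijection) : ConullBijection where
  toFun := fun x => ψ.toFun (φ.toFun x)
  dom := φ.dom ∩ φ.toFun ⁻¹' ψ.dom
  cod := ψ.toFun '' (φ.cod ∩ ψ.dom)
  measurable_toFun := ψ.measurable_toFun.comp φ.measurable_toFun
  measurableSet_dom := φ.measurableSet_dom.inter (φ.measurable_toFun ψ.measurableSet_dom)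
  measurableSet_cod := ψ.measurableSet_image φ.measurableSet_cod
  conull_dom := by
    have h : ∀ᵐ x, φ.toFun x ∈ ψ.dom :=
      φ.measurePreserving.quasiMeasurePreserving.ae ψ.ae_dom
    have : ∀ᵐ x, x ∈ φ.dom ∩ φ.toFun ⁻¹' ψ.dom := by
      filter_upwards [φ.ae_dom, h] with x h1 h2 using ⟨h1, h2⟩
    exact this
  conull_cod := by
    rw [prob_compl_eq_zero_iff (ψ.measurableSet_image φ.measurableSet_cod),
      ψ.measure_image _ inter_subset_right (φ.measurableSet_cod.inter ψ.measurableSet_dom),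
      ← prob_compl_eq_zero_iff (φ.measurableSet_cod.inter ψ.measurableSet_dom)]
    have : ∀ᵐ x, x ∈ φ.cod ∩ ψ.dom := by
      filter_upwards [φ.ae_cod, ψ.ae_dom] with x h1 h2 using ⟨h1, h2⟩
    exact this
  bijOn := by
    refine ⟨fun x hx => ⟨φ.toFun x, ⟨φ.bijOn.mapsTo hx.1, hx.2⟩, rfl⟩, ?_, ?_⟩
    · intro x hx y hy hxy
      exact φ.bijOn.injOn hx.1 hy.1 (ψ.bijOn.injOn hx.2 hy.2 hxy)
    · rintro _ ⟨y, ⟨hy, hyd⟩, rfl⟩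
      obtain ⟨x, hx, rfl⟩ := φ.bijOn.surjOn hy
      exact ⟨x, ⟨hx, hyd⟩, rfl⟩
  measure_image := by
    intro S hS hSm
    have hSφ : S ⊆ φ.dom := fun x hx => (hS hx).1
    have e : φ.toFun '' S = φ.toFun '' (S ∩ φ.dom) := by rw [inter_eq_left.2 hSφ]
    have : (fun x => ψ.toFun (φ.toFun x)) '' S = ψ.toFun '' (φ.toFun '' S) := by
      rw [image_image]
    rw [this, ψ.measure_image, φ.measure_image S hSφ hSm]
    · rintro _ ⟨x, hx, rfl⟩
      exact (hS hx).2
    · rw [e]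
      exact φ.measurableSet_image hSm

open Classical in
/-- The inverse on `cod`, extended by `0`. -/
def invFun (φ : ConullBijection) (y : I) : I :=
  if y ∈ φ.cod then Function.invFunOn φ.toFun φ.dom y else 0

lemma invFun_mem (φ : ConullBijection) {y : I} (hy : y ∈ φ.cod) : φ.invFun y ∈ φ.dom := by
  rw [invFun, if_pos hy]
  exact Function.invFunOn_mem (φ.bijOn.surjOn hy)

lemma apply_invFun (φ : ConullBijection) {y : I} (hy : y ∈ φ.cod) :
    φ.toFun (φ.invFun y) = y := by
  rw [invFun, if_pos hy]
  exact Function.invFunOn_eq (φ.bijOn.surjOn hy)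

lemma invFun_apply (φ : ConullBijection) {x : I} (hx : x ∈ φ.dom) :
    φ.invFun (φ.toFun x) = x :=
  φ.bijOn.injOn (φ.invFun_mem (φ.bijOn.mapsTo hx)) hx (φ.apply_invFun (φ.bijOn.mapsTo hx))

/-- The inverse. -/
protected def symm (φ : ConullBijection) : ConullBijection where
  toFun := φ.invFun
  dom := φ.cod
  cod := φ.dom
  measurable_toFun := by
    intro S hS
    have : φ.invFun ⁻¹' S =
        φ.toFun '' (S ∩ φ.dom) ∪ (φ.codᶜ ∩ {_y | (0 : I) ∈ S}) := by
      ext y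
      by_cases hy : y ∈ φ.cod
      · constructor
        · intro h
          exact Or.inl ⟨φ.invFun y, ⟨h, φ.invFun_mem hy⟩, φ.apply_invFun hy⟩
        · rintro (⟨x, ⟨hx, hxd⟩, rfl⟩ | h)
          · rw [mem_preimage, φ.invFun_apply hxd]
            exact hx
          · exact absurd hy h.1
      · have h0 : φ.invFun y = 0 := by rw [invFun, if_neg hy]
        constructor
        · intro h
          rw [mem_preimage, h0] at h
          exact Or.inr ⟨hy, h⟩
        · rintro (⟨x, ⟨hx, hxd⟩, rfl⟩ | h)
          · exact absurd (φ.bijOn.mapsTo hxd) hy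
          · rw [mem_preimage, h0]
            exact h.2
    rw [this]
    exact (φ.measurableSet_image hS).union (φ.measurableSet_cod.compl.inter (.const _))
  measurableSet_dom := φ.measurableSet_cod
  measurableSet_cod := φ.measurableSet_dom
  conull_dom := φ.conull_cod
  conull_cod := φ.conull_dom
  bijOn := by
    refine ⟨fun y hy => φ.invFun_mem hy, ?_, ?_⟩
    · intro y hy z hz h
      rw [← φ.apply_invFun hy, h, φ.apply_invFun hz]
    · intro x hx
      exact ⟨φ.toFun x, φ.bijOn.mapsTo hx, φ.invFun_apply hx⟩
  measure_image := by
    intro S hS hSm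
    have h1 : φ.invFun '' S = φ.toFun ⁻¹' S ∩ φ.dom := by
      ext x
      constructor
      · rintro ⟨y, hy, rfl⟩
        refine ⟨?_, φ.invFun_mem (hS hy)⟩
        rw [mem_preimage, φ.apply_invFun (hS hy)]
        exact hy
      · rintro ⟨hx, hxd⟩
        exact ⟨φ.toFun x, hx, φ.invFun_apply hxd⟩
    have h2 : φ.toFun '' (φ.toFun ⁻¹' S ∩ φ.dom) = S := by
      rw [← h1, image_image]
      ext y
      constructor
      · rintro ⟨z, hz, rfl⟩
        change φ.toFun (φ.invFun z) ∈ S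
        rw [φ.apply_invFun (hS hz)]
        exact hz
      · intro hy
        exact ⟨y, hy, φ.apply_invFun (hS hy)⟩
    rw [h1, ← φ.measure_image _ inter_subset_right
      ((φ.measurable_toFun hSm).inter φ.measurableSet_dom), h2]

lemma prodMP (φ : ConullBijection) :
    MeasurePreserving (fun z : I × I => (φ.toFun z.1, φ.toFun z.2)) volume volume :=
  φ.measurePreserving.prod φ.measurePreserving

end ConullBijection

instance : Nonempty ConullBijection := ⟨ConullBijection.refl⟩

/-- The rectangle `S × T`. -/
abbrev rect (P : {S : Set I // MeasurableSet S} × {T : Set I // MeasurableSet T}) :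
    Set (I × I) := (P.1 : Set I) ×ˢ (P.2 : Set I)

lemma kernel_eq (W : I → I → ℝ) :
    kernelCutNorm W = supInt volume rect (fun z : I × I => W z.1 z.2) := rfl

lemma signal_eq (f : I → ℝ) :
    signalCutNorm f = supInt volume (fun S : {S : Set I // MeasurableSet S} => (S : Set I)) f := rfl

lemma GraphonSignal.bmW {r : ℝ} (u : GraphonSignal r) :
    BM (fun z : I × I => u.W z.1 z.2) :=
  ⟨u.measurable_W, 1, fun z => by
    rw [abs_of_nonneg (u.W_mem _ _).1]; exact (u.W_mem _ _).2⟩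

lemma GraphonSignal.bmf {r : ℝ} (u : GraphonSignal r) : BM u.f :=
  ⟨u.measurable_f, r, u.abs_f_le⟩

lemma kernel_comp_le (φ : ConullBijection) {F : I × I → ℝ} (hF : BM F) :
    supInt volume rect (fun z : I × I => F (φ.toFun z.1, φ.toFun z.2)) ≤
      supInt volume rect F := by
  refine supInt_comp_le rect hF φ.prodMP ?_
  rintro ⟨⟨S, hS⟩, ⟨T, hT⟩⟩
  refine ⟨(⟨_, φ.measurableSet_image hS⟩, ⟨_, φ.measurableSet_image hT⟩),
    (φ.measurableSet_image hS).prod (φ.measurableSet_image hT), ?_⟩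
  have := Measure.set_prod_ae_eq (φ.ae_eq_preimage S) (φ.ae_eq_preimage T)
  exact this

lemma signal_comp_le (φ : ConullBijection) {F : I → ℝ} (hF : BM F) :
    supInt volume (fun S : {S : Set I // MeasurableSet S} => (S : Set I))
        (fun z => F (φ.toFun z)) ≤
      supInt volume (fun S : {S : Set I // MeasurableSet S} => (S : Set I)) F := by
  refine supInt_comp_le _ hF φ.measurePreserving ?_
  rintro ⟨S, hS⟩
  exact ⟨⟨_, φ.measurableSet_image hS⟩, φ.measurableSet_image hS, φ.ae_eq_preimage S⟩

lemma cutMetric_nonneg (W : I → I → ℝ) (f : I → ℝ) (V : I → I → ℝ) (g : I → ℝ) :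
    0 ≤ cutMetric W f V g :=
  add_nonneg (supInt_nonneg _ _ _) (supInt_nonneg _ _ _)

lemma cutDist_le {r : ℝ} (u v : GraphonSignal r) (φ : ConullBijection) :
    cutDist u v ≤
      cutMetric u.W u.f (fun x y => v.W (φ.toFun x) (φ.toFun y)) (fun x => v.f (φ.toFun x)) :=
  ciInf_le ⟨0, by rintro _ ⟨φ, rfl⟩; exact cutMetric_nonneg _ _ _ _⟩ φ

lemma cutDist_self {r : ℝ} (u : GraphonSignal r) : cutDist u u = 0 := by
  refine le_antisymm ((cutDist_le u u ConullBijection.refl).trans ?_)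
    (Real.iInf_nonneg fun φ => cutMetric_nonneg _ _ _ _)
  simp [cutMetric, kernelCutNorm, signalCutNorm, ConullBijection.refl]

lemma cutDist_symm_le {r : ℝ} (u v : GraphonSignal r) : cutDist u v ≤ cutDist v u := by
  refine le_ciInf fun φ => (cutDist_le u v φ.symm).trans ?_
  have hinv : ∀ᵐ x : I, φ.toFun (φ.symm.toFun x) = x := by
    filter_upwards [φ.ae_cod] with x hx using φ.apply_invFun hx
  unfold cutMetric
  simp only [kernel_eq, signal_eq]
  refine add_le_add ?_ ?_
  · have h1 : BM (fun z : I × I => u.W (φ.toFun z.1) (φ.toFun z.2) - v.W z.1 z.2) :=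
      (u.bmW.comp φ.prodMP.measurable).sub v.bmW
    have h2 := kernel_comp_le φ.symm h1
    rw [← supInt_neg volume rect (F := fun z : I × I => v.W z.1 z.2 - u.W (φ.toFun z.1) (φ.toFun z.2))
      (G := fun z : I × I => u.W (φ.toFun z.1) (φ.toFun z.2) - v.W z.1 z.2) (fun z => by ring)]
    refine le_trans (le_of_eq (supInt_congr rect ?_)) h2
    have e1 : ∀ᵐ z : I × I, φ.toFun (φ.symm.toFun z.1) = z.1 :=
      Measure.quasiMeasurePreserving_fst.ae hinv
    have e2 : ∀ᵐ z : I × I, φ.toFun (φ.symm.toFun z.2) = z.2 :=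
      Measure.quasiMeasurePreserving_snd.ae hinv
    filter_upwards [e1, e2] with z h1 h2
    rw [h1, h2]
  · have h1 : BM (fun z : I => u.f (φ.toFun z) - v.f z) :=
      (u.bmf.comp φ.measurable_toFun).sub v.bmf
    have h2 := signal_comp_le φ.symm h1
    rw [← supInt_neg volume (fun S : {S : Set I // MeasurableSet S} => (S : Set I))
      (F := fun z : I => v.f z - u.f (φ.toFun z))
      (G := fun z : I => u.f (φ.toFun z) - v.f z) (fun z => by ring)]
    refine le_trans (le_of_eq (supInt_congr _ ?_)) h2
    filter_upwards [hinv] with z h1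
    rw [h1]

lemma cutDist_comm {r : ℝ} (u v : GraphonSignal r) : cutDist u v = cutDist v u :=
  le_antisymm (cutDist_symm_le u v) (cutDist_symm_le v u)

lemma cutDist_triangle {r : ℝ} (u v w : GraphonSignal r) :
    cutDist u w ≤ cutDist u v + cutDist v w := by
  refine le_ciInf_add_ciInf fun φ ψ => (cutDist_le u w (φ.trans ψ)).trans ?_
  unfold cutMetric
  simp only [kernel_eq, signal_eq]
  rw [add_add_add_comm]
  refine add_le_add ?_ ?_
  · have hv := v.bmW.comp φ.prodMP.measurable
    have hw := w.bmW.comp ψ.prodMP.measurable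
    refine (supInt_add_le volume rect (u.bmW.sub hv)
      ((v.bmW.sub hw).comp φ.prodMP.measurable) (fun z => ?_)).trans
      (add_le_add le_rfl (kernel_comp_le φ (v.bmW.sub hw)))
    simp [ConullBijection.trans]
  · have hv := v.bmf.comp φ.measurable_toFun
    have hw := w.bmf.comp ψ.measurable_toFun
    refine (supInt_add_le volume _ (u.bmf.sub hv)
      ((v.bmf.sub hw).comp φ.measurable_toFun) (fun z => ?_)).trans
      (add_le_add le_rfl (signal_comp_le φ (v.bmf.sub hw)))
    simp [ConullBijection.trans]

instance instPseudoMetricSpace (r : ℝ) : PseudoMetricSpace (GraphonSignal r) where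
  dist := cutDist
  dist_self := cutDist_self
  dist_comm := cutDist_comm
  dist_triangle := cutDist_triangle

/-! ### The graphon-signal space -/

/-- The graphon-signal space: graphon-signals modulo `δ_□ = 0`, with the induced metric `δ_□`. -/
abbrev GraphonSignalSpace (r : ℝ) : Type := SeparationQuotient (GraphonSignal r)

instance instMeasurableSpace (r : ℝ) : MeasurableSpace (GraphonSignalSpace r) := borel _

instance instBorelSpace (r : ℝ) : BorelSpace (GraphonSignalSpace r) := ⟨rfl⟩

/-! ### Covering numbers and the rate -/

/-- The explicit covering number `2 ^ k²` with `k = ⌈2 ^ (a / ε²)⌉`. -/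
def coverFormula (a ε : ℝ) : ℕ := 2 ^ (⌈(2 : ℝ) ^ (a / ε ^ 2)⌉₊ ^ 2)

/-- The covering function `κ` on `(0, ∞)`: it is the explicit formula for `ε ≤ ε₁`, where the
formula is valid, and is continued by its value at `ε₁` for `ε > ε₁`. -/
def kappa (a ε₁ ε : ℝ) : ℕ := coverFormula a (min ε ε₁)

/-- `ξ(ε) = κ(ε)² log κ(ε) / ε²`. -/
def xi (a ε₁ ε : ℝ) : ℝ := (kappa a ε₁ ε : ℝ) ^ 2 * Real.log (kappa a ε₁ ε) / ε ^ 2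

/-- The inverse of `ξ`. As `ξ` is strictly decreasing on `(0, ∞)` but jumps (because of the ceiling),
this is the generalized inverse: the least `ε > 0` with `ξ(ε) ≤ y`. It satisfies
`xiInv (ξ ε) = ε` for all `ε > 0`. -/
def xiInv (a ε₁ y : ℝ) : ℝ := sInf {ε : ℝ | 0 < ε ∧ xi a ε₁ ε ≤ y}

/-! ### The classification setting -/

/-- A ground truth classifier into `C` classes: the space is partitioned into Borel sets
`B 1, …, B C`, and the classifier is the standard basis vector `e i` on `B i`. -/
def IsClassifier {r : ℝ} {C : ℕ} (cl : GraphonSignalSpace r → Fin C → ℝ) : Prop :=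
  ∃ B : Fin C → Set (GraphonSignalSpace r),
    (∀ i, MeasurableSet (B i)) ∧ (∀ i j, i ≠ j → Disjoint (B i) (B j)) ∧ (⋃ i, B i) = univ ∧
      ∀ i, ∀ x ∈ B i, cl x = Pi.single i 1

/-- The statistical risk. -/
def statRisk {r : ℝ} {C : ℕ} (ν : Measure (GraphonSignalSpace r))
    (loss : (Fin C → ℝ) × (Fin C → ℝ) → ℝ) (cl Υ : GraphonSignalSpace r → Fin C → ℝ) : ℝ :=
  ∫ x, loss (Υ x, cl x) ∂ν

/-- The empirical risk on the samples `X 1, …, X N`. -/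
def empRisk {r : ℝ} {C N : ℕ}
    (loss : (Fin C → ℝ) × (Fin C → ℝ) → ℝ) (cl Υ : GraphonSignalSpace r → Fin C → ℝ)
    (X : Fin N → GraphonSignalSpace r) : ℝ :=
  (1 / (N : ℝ)) * ∑ i, loss (Υ (X i), cl (X i))

end

end GraphonSignals

/-!
Covering. As long as a step function differs from a graphon by more than `η` in cut norm, there is a
rectangle on which the difference integrates to more than `η`; adding this value on the rectangle
cuts each part into at most four and lowers the squared `L²` distance by `η²`. This stops after
`1 / (4 η²)` steps, which is the Frieze–Kannan weak regularity lemma. A measure preserving map then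
sorts the points by their part and by the level of the signal, so that, up to few cells of a grid, a
graphon-signal is within `ε` of one described by finitely many labels.

Generalization. Fix a finite cover by balls of radius `e`. Up to an error `2 L e`, a Lipschitz loss
depends on a point only through its ball and its class. Hoeffding's inequality for each set of
pairs (ball, class) bounds the total variation distance between the law of the pair and its
empirical version, and this single event serves all losses and all models at once. The rate `ξ⁻¹`
balances the scale `e` against the deviation, where `κ(e) ≥ 64 / e²` absorbs the oscillation of the
loss.
-/

namespace GraphonSignals

noncomputable section

open MeasureTheory ProbabilityTheory Set
open scoped unitInterval NNReal ENNReal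

/-! ### Empirical measures -/

section Empirical

variable {Ω : Type*} [MeasurableSpace Ω] {N : ℕ}

/-- The empirical measure `N⁻¹ ∑ i, δ_(X i)` of a sample `X`; integrals against it are sample
averages. -/
def empiricalMeasure (X : Fin N → Ω) : Measure Ω :=
  (N : ℝ≥0∞)⁻¹ • ∑ i, Measure.dirac (X i)

instance [NeZero N] (X : Fin N → Ω) : IsProbabilityMeasure (empiricalMeasure X) where
  measure_univ := by
    simp [empiricalMeasure,
      ENNReal.inv_mul_cancel (by simp [NeZero.ne N]) (ENNReal.natCast_ne_top N)]

lemma integral_empiricalMeasure (X : Fin N → Ω) {g : Ω → ℝ} (hg : Measurable g) :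
    ∫ x, g x ∂(empiricalMeasure X) = 1 / N * ∑ i, g (X i) := by
  rw [empiricalMeasure, integral_smul_measure,
    integral_finsetSum_measure fun i _ => integrable_dirac' hg.stronglyMeasurable (by simp)]
  simp [integral_dirac' _ _ hg.stronglyMeasurable]

lemma measureReal_empiricalMeasure (X : Fin N → Ω) {A : Set Ω} (hA : MeasurableSet A) :
    (empiricalMeasure X).real A = 1 / N * ∑ i, A.indicator 1 (X i) := by
  rw [← integral_empiricalMeasure X (measurable_one.indicator hA), integral_indicator_one hA]

lemma measurable_measureReal_empiricalMeasure {A : Set Ω} (hA : MeasurableSet A) :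
    Measurable fun X : Fin N → Ω => (empiricalMeasure X).real A := by
  simp only [measureReal_empiricalMeasure _ hA]
  exact (Finset.measurable_sum _ fun i _ =>
    (measurable_one.indicator hA).comp (measurable_pi_apply i)).const_mul _

lemma measureReal_pi_add_le_empiricalMeasure_le [NeZero N] (ν : Measure Ω) [IsProbabilityMeasure ν]
    {A : Set Ω} (hA : MeasurableSet A) {t : ℝ} (ht : 0 ≤ t) :
    (Measure.pi fun _ : Fin N => ν).real {X | ν.real A + t ≤ (empiricalMeasure X).real A} ≤
      Real.exp (-(2 * N * t ^ 2)) := by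
  set S : Ω → ℝ := fun x => A.indicator 1 x - ν.real A
  have hN : (0 : ℝ) < N := Nat.cast_pos.2 (NeZero.pos N)
  have hind : Measurable (A.indicator (1 : Ω → ℝ)) := measurable_one.indicator hA
  have hsub : HasSubgaussianMGF S ((‖(1 : ℝ) - 0‖₊ / 2) ^ 2) ν := by
    have h := hasSubgaussianMGF_of_mem_Icc (μ := ν) (a := 0) (b := 1) hind.aemeasurable
      (.of_forall fun x => by by_cases hx : x ∈ A <;> simp [hx])
    rwa [integral_indicator_one hA] at h
  have hsub_coord : ∀ i ∈ (Finset.univ : Finset (Fin N)), HasSubgaussianMGF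
      (fun X : Fin N → Ω => S (X i)) ((‖(1 : ℝ) - 0‖₊ / 2) ^ 2) (Measure.pi fun _ => ν) :=
    fun i _ => by
      have hi := measurePreserving_eval (fun _ : Fin N => ν) i
      refine HasSubgaussianMGF.of_map (X := S) hi.measurable.aemeasurable ?_
      rwa [hi.map_eq]
  have hset : {X : Fin N → Ω | ν.real A + t ≤ (empiricalMeasure X).real A} =
      {X | N * t ≤ ∑ i, S (X i)} := by
    ext X
    simp only [mem_ofPred_eq, measureReal_empiricalMeasure X hA, S, Finset.sum_sub_distrib,
      Finset.sum_const, Finset.card_univ, Fintype.card_fin, nsmul_eq_mul, one_div,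
      le_inv_mul_iff₀ hN, le_sub_iff_add_le', mul_add]
  rw [hset]
  refine (HasSubgaussianMGF.measure_sum_ge_le_of_iIndepFun
    (iIndepFun_pi fun _ => (hind.sub_const _).aemeasurable) hsub_coord
    (mul_nonneg hN.le ht)).trans_eq ?_
  have hvar : ((∑ _i : Fin N, (‖(1 : ℝ) - 0‖₊ / 2) ^ 2 : ℝ≥0) : ℝ) = N / 4 := by
    simp only [sub_zero, nnnorm_one, Finset.sum_const, Finset.card_univ, Fintype.card_fin,
      nsmul_eq_mul]
    push_cast
    ring
  rw [hvar]
  congr 1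
  field_simp
  norm_num

lemma exists_event_empiricalMeasure_le [NeZero N] (ν : Measure Ω) [IsProbabilityMeasure ν]
    {T : Type*} [Finite T] [MeasurableSpace T] [DiscreteMeasurableSpace T] {τ : Ω → T}
    (hτ : Measurable τ) {t : ℝ} (ht : 0 ≤ t) :
    ∃ U : Set (Fin N → Ω), MeasurableSet U ∧
      1 - 2 ^ Nat.card T * Real.exp (-(2 * N * t ^ 2)) ≤ (Measure.pi fun _ => ν).real U ∧
      ∀ X ∈ U, ∀ A : Set T, (empiricalMeasure X).real (τ ⁻¹' A) ≤ ν.real (τ ⁻¹' A) + t := by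
  cases nonempty_fintype T
  classical
  let bad : Set T → Set (Fin N → Ω) := fun A =>
    {X | ν.real (τ ⁻¹' A) + t ≤ (empiricalMeasure X).real (τ ⁻¹' A)}
  have hτA (A : Set T) : MeasurableSet (τ ⁻¹' A) := hτ (.of_discrete)
  have hbad : MeasurableSet (⋃ A, bad A) := .iUnion fun A =>
    measurableSet_le measurable_const (measurable_measureReal_empiricalMeasure (hτA A))
  refine ⟨(⋃ A, bad A)ᶜ, hbad.compl, ?_, fun X hX A => ?_⟩
  · rw [probReal_compl_eq_one_sub hbad]
    refine sub_le_sub_left ?_ _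
    calc (Measure.pi fun _ => ν).real (⋃ A, bad A)
        ≤ ∑ A, (Measure.pi fun _ => ν).real (bad A) := measureReal_iUnion_fintype_le _
      _ ≤ ∑ _A : Set T, Real.exp (-(2 * N * t ^ 2)) := Finset.sum_le_sum fun A _ =>
          measureReal_pi_add_le_empiricalMeasure_le ν (hτA A) ht
      _ = 2 ^ Nat.card T * Real.exp (-(2 * N * t ^ 2)) := by
          simp [Fintype.card_set]
  · exact (not_le.1 fun h => hX (mem_iUnion.2 ⟨A, h⟩)).le

end Empirical

section Deviation

variable {Ω : Type*} [MeasurableSpace Ω] {μ ν : Measure Ω} [IsProbabilityMeasure μ]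
  [IsProbabilityMeasure ν] {t : ℝ}

lemma integral_le_integral_add_of_measureReal_le
    (h : ∀ A, MeasurableSet A → μ.real A ≤ ν.real A + t)
    {f : Ω → ℝ} (hf : Measurable f) {M : ℝ} (hfM : ∀ x, f x ∈ Icc 0 M) :
    ∫ x, f x ∂μ ≤ ∫ x, f x ∂ν + M * t := by
  have hint (ρ : Measure Ω) [IsProbabilityMeasure ρ] : Integrable f ρ :=
    .of_mem_Icc 0 M hf.aemeasurable (.of_forall hfM)
  have hlayer (ρ : Measure Ω) [IsProbabilityMeasure ρ] :
      ∫ x, f x ∂ρ = ∫ s in Ioc 0 M, ρ.real {x | s ≤ f x} :=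
    (hint ρ).integral_eq_integral_Ioc_meas_le (.of_forall fun x => (hfM x).1)
      (.of_forall fun x => (hfM x).2)
  have hlevel (ρ : Measure Ω) [IsProbabilityMeasure ρ] :
      IntegrableOn (fun s => ρ.real {x | s ≤ f x}) (Ioc 0 M) := by
    have hanti : Antitone fun s => ρ.real {x | s ≤ f x} := fun s s' hs =>
      measureReal_mono fun x hx => hs.trans hx
    exact (hanti.locallyIntegrable.integrableOn_isCompact isCompact_Icc).mono_set
      Ioc_subset_Icc_self
  obtain ⟨x₀⟩ : Nonempty Ω := nonempty_of_isProbabilityMeasure μ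
  have hM : 0 ≤ M := (hfM x₀).1.trans (hfM x₀).2
  calc ∫ x, f x ∂μ = ∫ s in Ioc 0 M, μ.real {x | s ≤ f x} := hlayer μ
    _ ≤ ∫ s in Ioc 0 M, (ν.real {x | s ≤ f x} + t) :=
        integral_mono (hlevel μ) ((hlevel ν).add (integrable_const t)) fun s =>
          h _ (measurableSet_le measurable_const hf)
    _ = ∫ x, f x ∂ν + M * t := by
        rw [integral_add (hlevel ν) (integrable_const t), ← hlayer ν]
        simp [hM]

lemma abs_integral_sub_integral_le_of_measureReal_le
    (h : ∀ A, MeasurableSet A → μ.real A ≤ ν.real A + t)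
    {f : Ω → ℝ} (hf : Measurable f) {b R : ℝ} (hfb : ∀ x, |f x - b| ≤ R) :
    |∫ x, f x ∂μ - ∫ x, f x ∂ν| ≤ 2 * R * t := by
  have hint (ρ : Measure Ω) [IsProbabilityMeasure ρ] : Integrable f ρ :=
    .of_mem_Icc (b - R) (b + R) hf.aemeasurable (.of_forall fun x => by
      constructor <;> linarith [abs_le.1 (hfb x)])
  have hup := integral_le_integral_add_of_measureReal_le h (hf.sub_const (b - R)) (M := 2 * R)
    fun x => by constructor <;> linarith [abs_le.1 (hfb x)]
  have hlow := integral_le_integral_add_of_measureReal_le h (hf.const_sub (b + R)) (M := 2 * R)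
    fun x => by constructor <;> linarith [abs_le.1 (hfb x)]
  rw [integral_sub (hint μ) (integrable_const _), integral_sub (hint ν) (integrable_const _)] at hup
  rw [integral_sub (integrable_const _) (hint μ),
    integral_sub (integrable_const _) (hint ν)] at hlow
  simp only [integral_const, probReal_univ, one_smul] at hup hlow
  exact abs_le.2 ⟨by linarith, by linarith⟩

lemma abs_integral_sub_integral_le_of_discretization {T : Type*} [Countable T] [MeasurableSpace T]
    [DiscreteMeasurableSpace T] {τ : Ω → T} (hτ : Measurable τ)
    (h : ∀ A : Set T, μ.real (τ ⁻¹' A) ≤ ν.real (τ ⁻¹' A) + t) {g : Ω → ℝ} (hg : Measurable g)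
    {c : T → ℝ} {b R δ : ℝ} (hc : ∀ k, |c k - b| ≤ R) (hgc : ∀ x, |g x - c (τ x)| ≤ δ) :
    |∫ x, g x ∂μ - ∫ x, g x ∂ν| ≤ 2 * δ + 2 * R * t := by
  have hcm : Measurable c := .of_discrete
  have hcτ (ρ : Measure Ω) [IsProbabilityMeasure ρ] : Integrable (fun x => c (τ x)) ρ :=
    .of_mem_Icc (b - R) (b + R) (hcm.comp hτ).aemeasurable (.of_forall fun x => by
      constructor <;> linarith [abs_le.1 (hc (τ x))])
  have hgi (ρ : Measure Ω) [IsProbabilityMeasure ρ] : Integrable g ρ :=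
    .of_mem_Icc (b - R - δ) (b + R + δ) hg.aemeasurable (.of_forall fun x => by
      constructor <;> linarith [abs_le.1 (hc (τ x)), abs_le.1 (hgc x)])
  have hclose (ρ : Measure Ω) [IsProbabilityMeasure ρ] :
      |∫ x, g x ∂ρ - ∫ x, c (τ x) ∂ρ| ≤ δ := by
    rw [← integral_sub (hgi ρ) (hcτ ρ)]
    simpa using norm_integral_le_of_norm_le_const (f := fun x => g x - c (τ x)) (μ := ρ)
      (.of_forall hgc)
  have hpush : |∫ x, c (τ x) ∂μ - ∫ x, c (τ x) ∂ν| ≤ 2 * R * t := by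
    have := Measure.isProbabilityMeasure_map (μ := μ) hτ.aemeasurable
    have := Measure.isProbabilityMeasure_map (μ := ν) hτ.aemeasurable
    rw [← integral_map hτ.aemeasurable hcm.aestronglyMeasurable,
      ← integral_map hτ.aemeasurable hcm.aestronglyMeasurable]
    refine abs_integral_sub_integral_le_of_measureReal_le (fun A hA => ?_) hcm hc
    rw [map_measureReal_apply hτ hA, map_measureReal_apply hτ hA]
    exact h A
  have := abs_le.1 (hclose μ)
  have := abs_le.1 (hclose ν)
  have := abs_le.1 hpush
  exact abs_le.2 ⟨by linarith, by linarith⟩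

end Deviation

/-! ### Generalization from a finite cover -/

section Generalization

variable {Ω ι : Type*} [PseudoMetricSpace Ω] [MeasurableSpace Ω]

lemma exists_measurable_ball_index [OpensMeasurableSpace Ω] {κ : ℕ} {z : Fin κ → Ω} {e : ℝ}
    (hz : (⋃ i, Metric.ball (z i) e) = univ) :
    ∃ j : Ω → Fin κ, Measurable j ∧ ∀ x, dist x (z (j x)) < e := by
  classical
  have hex (x : Ω) : ∃ i, x ∈ Metric.ball (z i) e := mem_iUnion.1 (hz ▸ mem_univ x)
  refine ⟨fun x => Fin.find _ (hex x), measurable_to_countable' fun i => ?_,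
    fun x => Fin.find_spec (hex x)⟩
  have hfiber : (fun x => Fin.find _ (hex x)) ⁻¹' {i} =
      Metric.ball (z i) e ∩ ⋂ j : Fin κ, ⋂ _ : j < i, (Metric.ball (z j) e)ᶜ := by
    ext x
    simp [Fin.find_eq_iff]
  rw [hfiber]
  exact measurableSet_ball.inter (.iInter fun j => .iInter fun _ => measurableSet_ball.compl)

variable [MeasurableSpace ι] [DiscreteMeasurableSpace ι]

lemma exists_event_lipschitz_family [OpensMeasurableSpace Ω] [Finite ι] (ν : Measure Ω)
    [IsProbabilityMeasure ν] {κ N : ℕ} [NeZero N] {z : Fin κ → Ω} {e : ℝ}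
    (hz : (⋃ i, Metric.ball (z i) e) = univ) {cls : Ω → ι} (hcls : Measurable cls) {t : ℝ}
    (ht : 0 ≤ t) :
    ∃ U : Set (Fin N → Ω), MeasurableSet U ∧
      1 - 2 ^ (κ * Nat.card ι) * Real.exp (-(2 * N * t ^ 2)) ≤ (Measure.pi fun _ => ν).real U ∧
      ∀ X ∈ U, ∀ (g : ι → Ω → ℝ) (L : ℝ≥0) (R : ℝ), (∀ i, LipschitzWith L (g i)) →
        (∀ i j x y, |g i x - g j y| ≤ R) →
        |∫ x, g (cls x) x ∂ν - 1 / N * ∑ i, g (cls (X i)) (X i)| ≤ 2 * (L * e) + 2 * R * t := by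
  obtain ⟨j, hj, hjz⟩ := exists_measurable_ball_index hz
  obtain ⟨U, hU, hνU, hUX⟩ :=
    exists_event_empiricalMeasure_le (N := N) ν (hj.prodMk hcls) ht
  refine ⟨U, hU, by simpa using hνU, fun X hX g L R hL hR => ?_⟩
  have hg : Measurable fun x => g (cls x) x :=
    (measurable_from_prod_countable_right (f := fun k : ι × Ω => g k.1 k.2)
      fun i => (hL i).continuous.measurable).comp (hcls.prodMk measurable_id)
  rw [← integral_empiricalMeasure X hg, abs_sub_comm]
  refine abs_integral_sub_integral_le_of_discretization (hj.prodMk hcls) (hUX X hX) hg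
    (c := fun k => g k.2 (z k.1)) (b := g (cls (X 0)) (X 0)) (fun k => hR _ _ _ _) fun x => ?_
  rw [← Real.dist_eq]
  exact ((hL _).dist_le_mul _ _).trans (by gcongr; exact (hjz x).le)

end Generalization

section Loss

variable {ι : Type*} [Fintype ι] {L₁ L₂ : ℝ≥0} {loss : (ι → ℝ) × (ι → ℝ) → ℝ}

lemma lipschitzWith_loss_const {Ω : Type*} [PseudoEMetricSpace Ω] (hloss : LipschitzWith L₂ loss)
    {Υ : Ω → ι → ℝ} (hΥ : LipschitzWith L₁ Υ) (w : ι → ℝ) :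
    LipschitzWith (L₂ * L₁) fun x => loss (Υ x, w) := by
  simpa [Function.comp_def] using hloss.comp (hΥ.prodMk (LipschitzWith.const w))

lemma dist_single_one_le_one [DecidableEq ι] (i j : ι) :
    dist (Pi.single i 1 : ι → ℝ) (Pi.single j 1) ≤ 1 := by
  refine (dist_pi_le_iff zero_le_one).2 fun k => Real.dist_le_of_mem_Icc_01 ?_ ?_ <;>
  · rw [Pi.single_apply]
    split_ifs <;> simp

lemma abs_loss_sub_loss_le [DecidableEq ι] {Ω : Type*} [PseudoMetricSpace Ω]
    (hloss : LipschitzWith L₂ loss) {Υ : Ω → ι → ℝ} (hΥ : LipschitzWith L₁ Υ) {D : ℝ}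
    (hD : ∀ x y : Ω, dist x y ≤ D) (i j : ι) (x y : Ω) :
    |loss (Υ x, Pi.single i 1) - loss (Υ y, Pi.single j 1)| ≤ L₂ * (1 + L₁ * D) := by
  have hΥD : dist (Υ x) (Υ y) ≤ L₁ * D := (hΥ.dist_le_mul x y).trans (by gcongr; exact hD x y)
  rw [← Real.dist_eq]
  refine (hloss.dist_le_mul _ _).trans (mul_le_mul_of_nonneg_left ?_ L₂.2)
  exact max_le (by linarith) ((dist_single_one_le_one i j).trans
    (by linarith [dist_nonneg.trans hΥD]))

end Loss

/-! ### Rearrangement of partitions of the unit interval -/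

section ProbabilityIntegralTransform

variable (μ : Measure ℝ)

/-- The distribution function of `μ` with values in the unit interval. -/
def unitCdf (u : ℝ) : I := ⟨cdf μ u, cdf_nonneg μ u, cdf_le_one μ u⟩

lemma monotone_unitCdf : Monotone (unitCdf μ) := fun _ _ huv => (cdf μ).mono huv

variable [IsProbabilityMeasure μ] [NullSingletonClass μ]

lemma continuous_cdf : Continuous (cdf μ) := by
  refine continuous_iff_continuousAt.2 fun x =>
    (cdf μ).mono.continuousAt_iff_leftLim_eq_rightLim.2 ?_
  have hjump : μ {x} = 0 := measure_singleton x
  rw [← measure_cdf μ, StieltjesFunction.measure_singleton, ENNReal.ofReal_eq_zero] at hjump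
  rw [StieltjesFunction.rightLim_eq]
  linarith [(cdf μ).mono.leftLim_le (le_refl x)]

lemma measureReal_cdf_le {s : ℝ} (hs : s ∈ Icc (0 : ℝ) 1) : μ.real {u | cdf μ u ≤ s} = s := by
  rcases hs.2.eq_or_lt with rfl | hs1
  · simp [cdf_le_one]
  obtain ⟨b, hb⟩ := ((tendsto_cdf_atTop μ).eventually (lt_mem_nhds hs1)).exists
  rcases eq_empty_or_nonempty {u | cdf μ u ≤ s} with hempty | hne
  · have hs0 : s ≤ 0 := ge_of_tendsto' (tendsto_cdf_atBot μ) fun u =>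
      (not_le.1 fun hu => (eq_empty_iff_forall_notMem.1 hempty u) hu).le
    rw [hempty, measureReal_empty, le_antisymm hs0 hs.1]
  · have hbdd : BddAbove {u | cdf μ u ≤ s} :=
      ⟨b, fun u hu => ((cdf μ).mono.reflect_lt (lt_of_le_of_lt hu hb)).le⟩
    set v := sSup {u | cdf μ u ≤ s}
    have hv : cdf μ v ≤ s :=
      (isClosed_le (continuous_cdf μ) continuous_const).csSup_mem hne hbdd
    have hIic : {u | cdf μ u ≤ s} = Iic v :=
      Subset.antisymm (fun u hu => le_csSup hbdd hu) fun u hu => ((cdf μ).mono hu).trans hv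
    obtain ⟨u, hu⟩ : s ∈ range (cdf μ) :=
      mem_range_of_exists_le_of_exists_ge (continuous_cdf μ) hne ⟨b, hb.le⟩
    rw [hIic, ← cdf_eq_real]
    exact le_antisymm hv (hu.ge.trans ((cdf μ).mono (le_csSup hbdd hu.le)))

lemma measurePreserving_unitCdf : MeasurePreserving (unitCdf μ) μ volume := by
  have hm : Measurable (unitCdf μ) := (monotone_unitCdf μ).measurable
  have := Measure.isProbabilityMeasure_map (μ := μ) hm.aemeasurable
  refine ⟨hm, Measure.ext_of_Iic _ _ fun s => ?_⟩
  rw [Measure.map_apply hm measurableSet_Iic, unitInterval.volume_Iic]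
  rw [← ofReal_measureReal (s := unitCdf μ ⁻¹' Iic s)]
  exact congrArg ENNReal.ofReal (measureReal_cdf_le μ s.2)

end ProbabilityIntegralTransform

lemma injOn_preimage_compl_range_rat {α : Type*} [PartialOrder α] {F : ℝ → α} (hF : Monotone F) :
    InjOn F (F ⁻¹' (range fun t : ℚ => F t)ᶜ) := by
  have hlt {u v : ℝ} (huv : F u = F v) (hu : F u ∉ range fun t : ℚ => F t) : v ≤ u := by
    by_contra! hlt
    obtain ⟨t, hut, htv⟩ := exists_rat_btwn hlt
    exact hu ⟨t, ((hF htv.le).trans_eq huv.symm).antisymm (hF hut.le)⟩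
  exact fun u hu v hv huv => (hlt huv.symm hv).antisymm (hlt huv hu)

/-- A measure preserving map which is injective off a null set, as a bijection between co-null
sets. -/
def ConullBijection.ofInjOn {φ : I → I} (hφ : MeasurePreserving φ volume volume) {D : Set I}
    (hD : MeasurableSet D) (hD0 : volume Dᶜ = 0) (hinj : InjOn φ D) : ConullBijection :=
  have measurableSet_image {S : Set I} (hSD : S ⊆ D) (hS : MeasurableSet S) :
      MeasurableSet (φ '' S) := hS.image_of_measurable_injOn hφ.measurable (hinj.mono hSD)
  have volume_image {S : Set I} (hSD : S ⊆ D) (hS : MeasurableSet S) :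
      volume (φ '' S) = volume S := by
    rw [← hφ.measure_preimage (measurableSet_image hSD hS).nullMeasurableSet]
    refine measure_congr ?_
    have hae : ∀ᵐ x, x ∈ D := hD0
    filter_upwards [hae] with x hx
    refine propext ⟨?_, fun hxS => ⟨x, hxS, rfl⟩⟩
    rintro ⟨y, hy, hyx⟩
    exact hinj (hSD hy) hx hyx ▸ hy
  { toFun := φ
    dom := D
    cod := φ '' D
    measurable_toFun := hφ.measurable
    measurableSet_dom := hD
    measurableSet_cod := measurableSet_image subset_rfl hD
    conull_dom := hD0
    conull_cod := by
      rw [prob_compl_eq_zero_iff (measurableSet_image subset_rfl hD), volume_image subset_rfl hD,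
        ← prob_compl_eq_zero_iff hD, hD0]
    bijOn := hinj.bijOn_image
    measure_image := fun _ => volume_image }

/-- The increasing rearrangement is `F ∘ h`, where `F` is the distribution function of `h`. -/
lemma exists_conullBijection_monotone {h : I → ℝ} (hm : Measurable h)
    (hinj : Function.Injective h) :
    ∃ φ : ConullBijection, ∀ x y, h x ≤ h y → φ.toFun x ≤ φ.toFun y := by
  set μ : Measure ℝ := volume.map h
  have : IsProbabilityMeasure μ := Measure.isProbabilityMeasure_map hm.aemeasurable
  have : NullSingletonClass μ := ⟨fun u => by
    rw [Measure.map_apply hm (measurableSet_singleton u)]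
    exact (subsingleton_singleton.preimage hinj).measure_zero _⟩
  have hφ : MeasurePreserving (unitCdf μ ∘ h) volume volume :=
    (measurePreserving_unitCdf μ).comp ⟨hm, rfl⟩
  set B : Set I := range fun t : ℚ => unitCdf μ t
  have hB : B.Countable := countable_range _
  have hD0 : volume ((unitCdf μ ∘ h) ⁻¹' Bᶜ)ᶜ = 0 := by
    rw [← preimage_compl, compl_compl, hφ.measure_preimage hB.measurableSet.nullMeasurableSet]
    exact hB.measure_zero _
  refine ⟨.ofInjOn hφ (hφ.measurable hB.measurableSet.compl) hD0 ?_,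
    fun x y hxy => monotone_unitCdf μ hxy⟩
  exact (injOn_preimage_compl_range_rat (monotone_unitCdf μ)).comp hinj.injOn fun x hx => hx

lemma exists_conullBijection_sort {q : I → ℕ} (hq : Measurable q) :
    ∃ φ : ConullBijection, ∀ x y, q x < q y → φ.toFun x ≤ φ.toFun y := by
  have hlt {x y : I} (hxy : q x < q y) : (q x : ℝ) + x / 2 < q y + y / 2 := by
    have : (q x : ℝ) + 1 ≤ q y := mod_cast hxy
    linarith [x.2.2, y.2.1]
  obtain ⟨φ, hφ⟩ := exists_conullBijection_monotone (h := fun x => (q x : ℝ) + x / 2)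
    ((measurable_from_nat.comp hq).add (measurable_subtype_coe.div_const 2)) fun x y hxy => by
      rcases lt_trichotomy (q x) (q y) with h | h | h
      · exact absurd hxy (hlt h).ne
      · simp only [h] at hxy
        exact Subtype.ext (by linarith)
      · exact absurd hxy (hlt h).ne'
  exact ⟨φ, fun x y hxy => hφ x y (hlt hxy).le⟩

section Grid

variable (K : ℕ) [NeZero K]

/-- The index of the cell containing a point, in the partition of the unit interval into `K`
intervals of equal length; the minimum puts the endpoint `1` into the last cell. -/
def gridIndex (x : I) : Fin K :=
  ⟨min ⌊(K : ℝ) * x⌋₊ (K - 1), by have := NeZero.pos K; omega⟩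

lemma gridIndex_mono : Monotone (gridIndex K) := fun x y hxy =>
  have hxy' : (x : ℝ) ≤ y := hxy
  min_le_min_right _ (Nat.floor_le_floor (mul_le_mul_of_nonneg_left hxy' K.cast_nonneg))

lemma measurable_gridIndex : Measurable (gridIndex K) := (gridIndex_mono K).measurable

lemma gridIndex_le_mul (x : I) : (gridIndex K x : ℝ) ≤ K * x :=
  (Nat.cast_le.2 (min_le_left _ _)).trans (Nat.floor_le (mul_nonneg K.cast_nonneg x.2.1))

lemma mul_le_gridIndex_add_one (x : I) : (K : ℝ) * x ≤ (gridIndex K x : ℝ) + 1 := by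
  have hK : ((K - 1 : ℕ) : ℝ) + 1 = K := mod_cast Nat.sub_add_cancel (NeZero.pos K)
  simp only [gridIndex, Nat.cast_min]
  rcases min_choice (⌊(K : ℝ) * x⌋₊ : ℝ) ((K - 1 : ℕ) : ℝ) with h | h <;> rw [h]
  · exact (Nat.lt_floor_add_one _).le
  · rw [hK]
    exact mul_le_of_le_one_right K.cast_nonneg x.2.2

lemma abs_sub_gridIndex_div_le (x : I) : |(x : ℝ) - gridIndex K x / K| ≤ 1 / K := by
  have hK : (0 : ℝ) < K := Nat.cast_pos.2 (NeZero.pos K)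
  rw [← abs_of_pos hK, ← mul_le_mul_iff_right₀ (abs_pos.2 hK.ne'), ← abs_mul, abs_of_pos hK,
    mul_sub, mul_div_cancel₀ _ hK.ne', mul_div_cancel₀ _ hK.ne', abs_le]
  constructor <;> linarith [gridIndex_le_mul K x, mul_le_gridIndex_add_one K x]

lemma measureReal_gridIndex_le (b : Fin K) : volume.real (gridIndex K ⁻¹' {b}) ≤ 1 / K := by
  have hK : (0 : ℝ) < K := Nat.cast_pos.2 (NeZero.pos K)
  have hb : (b : ℝ) + 1 ≤ K := mod_cast b.2
  let l : I := ⟨b / K, by positivity, by rw [div_le_one hK]; linarith⟩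
  let u : I := ⟨(b + 1) / K, by positivity, by rwa [div_le_one hK]⟩
  have hsub : gridIndex K ⁻¹' {b} ⊆ Icc l u := by
    rintro x rfl
    constructor
    · exact (div_le_iff₀' hK).2 (gridIndex_le_mul K x)
    · exact (le_div_iff₀' hK).2 (mul_le_gridIndex_add_one K x)
  have hlu : (u : ℝ) - l = 1 / K := by simp only [l, u]; ring
  refine (measureReal_mono hsub).trans_eq ?_
  rw [measureReal_def, unitInterval.volume_Icc, hlu, ENNReal.toReal_ofReal (by positivity)]

end Grid

lemma exists_ncard_setOf_ne_le {α β ι : Type*} [PartialOrder β] [LinearOrder ι] [Finite ι]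
    [Nonempty ι] {J : α → β} {q : α → ι} (hJ : ∀ x y, q x < q y → J x ≤ J y) :
    ∃ c : β → ι, {b | ∃ x, J x = b ∧ q x ≠ c b}.Finite ∧
      {b | ∃ x, J x = b ∧ q x ≠ c b}.ncard ≤ Nat.card ι := by
  have hmin (b : β) : ∃ i, ∀ x, J x = b → i ≤ q x ∧ ∃ x', J x' = b ∧ q x' = i := by
    rcases (q '' (J ⁻¹' {b})).eq_empty_or_nonempty with h | h
    · exact ⟨Classical.arbitrary ι, fun x hx =>
        (eq_empty_iff_forall_notMem.1 h _ ⟨x, hx, rfl⟩).elim⟩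
    · obtain ⟨i, ⟨x', hx', rfl⟩, hi⟩ := WellFounded.has_min (wellFounded_lt) _ h
      exact ⟨_, fun x hx => ⟨not_lt.1 (hi _ ⟨x, hx, rfl⟩), x', hx', rfl⟩⟩
  choose c hc using hmin
  have hle {b b' : β} (hb : ∃ x, J x = b ∧ q x ≠ c b) (hb' : ∃ x, J x = b' ∧ q x ≠ c b')
      (hbb' : c b = c b') : b' ≤ b := by
    obtain ⟨x, rfl, hx⟩ := hb
    obtain ⟨y, rfl, -⟩ := hb'
    obtain ⟨y', hy', hqy'⟩ := (hc _ y rfl).2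
    rw [← hy']
    refine hJ _ _ ?_
    rw [hqy', ← hbb']
    exact (hc _ x rfl).1.lt_of_ne hx.symm
  have hinj : InjOn c {b | ∃ x, J x = b ∧ q x ≠ c b} := fun b hb b' hb' hbb' =>
    (hle hb' hb hbb'.symm).antisymm (hle hb hb' hbb')
  exact ⟨c, Finite.of_finite_image (toFinite _) hinj, (InjOn.ncard_image hinj).symm.trans_le
    (ncard_le_card _)⟩

/-- After sorting, only cells straddling two parts of the partition are bad, and there are at most
`n` of them. -/
lemma exists_conullBijection_grid {n : ℕ} {q : I → Fin n} (hq : Measurable q) (K : ℕ) [NeZero K] :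
    ∃ (φ : ConullBijection) (c : Fin K → Fin n) (B : Set I), MeasurableSet B ∧
      volume.real B ≤ n / K ∧ ∀ x ∉ B, q x = c (gridIndex K (φ.toFun x)) := by
  obtain ⟨φ, hφ⟩ := exists_conullBijection_sort ((measurable_of_finite Fin.val).comp hq)
  set J : I → Fin K := fun x => gridIndex K (φ.toFun x)
  have : Nonempty (Fin n) := ⟨q 0⟩
  obtain ⟨c, hfin, hcard⟩ := exists_ncard_setOf_ne_le (J := J) (q := q)
    fun x y hxy => gridIndex_mono K (hφ x y hxy)
  set bad := {b | ∃ x, J x = b ∧ q x ≠ c b}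
  have hcell (b : Fin K) : volume.real (J ⁻¹' {b}) ≤ 1 / K :=
    (φ.measurePreserving.measureReal_preimage
      (measurable_gridIndex K (measurableSet_singleton b)).nullMeasurableSet).trans_le
      (measureReal_gridIndex_le K b)
  refine ⟨φ, c, ⋃ b ∈ hfin.toFinset, J ⁻¹' {b},
    Finset.measurableSet_biUnion _ fun b _ => (measurable_gridIndex K).comp φ.measurable_toFun
      (measurableSet_singleton b), ?_, fun x hx => ?_⟩
  · calc volume.real (⋃ b ∈ hfin.toFinset, J ⁻¹' {b})
        ≤ ∑ b ∈ hfin.toFinset, volume.real (J ⁻¹' {b}) := measureReal_biUnion_finset_le _ _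
      _ ≤ ∑ _b ∈ hfin.toFinset, (1 / K : ℝ) := Finset.sum_le_sum fun b _ => hcell b
      _ = bad.ncard / K := by
          rw [Finset.sum_const, nsmul_eq_mul, mul_one_div, ncard_eq_toFinset_card _ hfin]
      _ ≤ n / K := by
          gcongr
          simpa using hcard
  · by_contra hne
    exact hx (by simpa using ⟨x, rfl, hne⟩)

/-! ### Weak regularity -/

lemma bm_comp_of_finite {Ω ι : Type*} [MeasurableSpace Ω] [MeasurableSpace ι]
    [MeasurableSingletonClass ι] [Finite ι] {q : Ω → ι} (hq : Measurable q) (c : ι → ℝ) :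
    BM fun z => c (q z) := by
  obtain ⟨M, hM⟩ := (finite_range fun i => |c i|).bddAbove
  exact ⟨(measurable_of_finite c).comp hq, M, fun z => hM ⟨q z, rfl⟩⟩

lemma bm_step {n : ℕ} {q : I → Fin n} (hq : Measurable q) (w : Fin n → Fin n → ℝ) :
    BM fun z : I × I => w (q z.1) (q z.2) :=
  bm_comp_of_finite ((hq.comp measurable_fst).prodMk (hq.comp measurable_snd)) fun k => w k.1 k.2

lemma BM.integrable_sq {Ω : Type*} [MeasurableSpace Ω] {μ : Measure Ω} [IsFiniteMeasure μ]
    {F : Ω → ℝ} (hF : BM F) : Integrable (fun z => F z ^ 2) μ := by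
  obtain ⟨hm, M, hM⟩ := hF
  refine BM.integrable ⟨hm.pow_const 2, M ^ 2, fun z => ?_⟩ μ
  rw [abs_pow]
  gcongr
  exact hM z

lemma integral_sub_indicator_setIntegral_sq_le {Ω : Type*} [MeasurableSpace Ω] {μ : Measure Ω}
    [IsProbabilityMeasure μ] {G : Ω → ℝ} (hG : BM G) {R : Set Ω} (hR : MeasurableSet R) :
    ∫ z, (G z - R.indicator (fun _ => ∫ y in R, G y ∂μ) z) ^ 2 ∂μ ≤
      ∫ z, G z ^ 2 ∂μ - (∫ z in R, G z ∂μ) ^ 2 := by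
  set c := ∫ y in R, G y ∂μ
  have expand : ∀ z, (G z - R.indicator (fun _ => c) z) ^ 2 =
      G z ^ 2 - R.indicator (fun z => 2 * c * G z - c ^ 2) z := fun z => by
    by_cases hz : z ∈ R
    · simp only [indicator_of_mem hz]
      ring
    · simp only [indicator_of_notMem hz, sub_zero]
  have hGR := (hG.integrable (μ.restrict R)).const_mul (2 * c)
  have gain : ∫ z in R, (2 * c * G z - c ^ 2) ∂μ = 2 * c * c - μ.real R * c ^ 2 := by
    rw [integral_sub hGR (integrable_const _), integral_const_mul, setIntegral_const, smul_eq_mul]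
  have hint : Integrable (R.indicator fun z => 2 * c * G z - c ^ 2) μ :=
    (((hG.integrable μ).const_mul _).sub (integrable_const _)).indicator hR
  simp only [expand]
  rw [integral_sub hG.integrable_sq hint, integral_indicator hR, gain]
  nlinarith [sq_nonneg c, measureReal_le_one (μ := μ) (s := R)]

lemma exists_refinement_add_indicator {n : ℕ} {q : I → Fin n} (hq : Measurable q)
    (w : Fin n → Fin n → ℝ) {S T : Set I} (hS : MeasurableSet S) (hT : MeasurableSet T) (c : ℝ) :
    ∃ q' : I → Fin (n * 4), Measurable q' ∧ ∃ w' : Fin (n * 4) → Fin (n * 4) → ℝ,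
      ∀ z : I × I, w' (q' z.1) (q' z.2) =
        w (q z.1) (q z.2) + (S ×ˢ T).indicator (fun _ => c) z := by
  classical
  let e : Fin n × Bool × Bool ≃ Fin (n * 4) := Fintype.equivFinOfCardEq (by simp)
  refine ⟨fun x => e (q x, decide (x ∈ S), decide (x ∈ T)),
    (measurable_of_finite e).comp (hq.prodMk ((measurable_to_bool ?_).prodMk
      (measurable_to_bool ?_))),
    fun i j => w (e.symm i).1 (e.symm j).1 +
      if (e.symm i).2.1 ∧ (e.symm j).2.2 then c else 0, fun z => ?_⟩
  · simpa [preimage] using hS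
  · simpa [preimage] using hT
  · simp [indicator_apply]

lemma sub_projIcc_sq_le {x : ℝ} (hx : x ∈ Icc (0 : ℝ) 1) (y : ℝ) :
    (x - projIcc (0 : ℝ) 1 zero_le_one y) ^ 2 ≤ (x - y) ^ 2 := by
  have h := abs_projIcc_sub_projIcc (a := (0 : ℝ)) (b := 1) zero_le_one (c := x) (d := y)
  rw [projIcc_of_mem _ hx] at h
  exact sq_le_sq.2 h

lemma exists_refinement_integral_sq_le {F : I × I → ℝ} (hF : Measurable F)
    (h01 : ∀ z, F z ∈ Icc (0 : ℝ) 1) {n : ℕ} {q : I → Fin n} (hq : Measurable q)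
    (w : Fin n → Fin n → I) {η : ℝ} (hη : 0 ≤ η)
    (hcut : η < supInt volume rect fun z => F z - w (q z.1) (q z.2)) :
    ∃ q' : I → Fin (n * 4), Measurable q' ∧ ∃ w' : Fin (n * 4) → Fin (n * 4) → I,
      ∫ z, (F z - w' (q' z.1) (q' z.2)) ^ 2 ≤
        (∫ z, (F z - w (q z.1) (q z.2)) ^ 2) - η ^ 2 := by
  have hFB : BM F := ⟨hF, 1, fun z => abs_le.2 ⟨by linarith [(h01 z).1], (h01 z).2⟩⟩
  set G : I × I → ℝ := fun z => F z - w (q z.1) (q z.2)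
  have hG : BM G := hFB.sub (bm_step hq fun i j => w i j)
  obtain ⟨⟨⟨S, hS⟩, ⟨T, hT⟩⟩, hST⟩ := exists_lt_of_lt_ciSup hcut
  set c := ∫ z in S ×ˢ T, G z
  obtain ⟨q', hq', v, hv⟩ := exists_refinement_add_indicator hq (fun i j => w i j) hS hT c
  have hvG : ∀ z, F z - v (q' z.1) (q' z.2) = G z - (S ×ˢ T).indicator (fun _ => c) z :=
    fun z => by rw [hv, sub_add_eq_sub_sub]
  refine ⟨q', hq', fun i j => projIcc 0 1 zero_le_one (v i j), ?_⟩
  calc ∫ z, (F z - projIcc (0 : ℝ) 1 zero_le_one (v (q' z.1) (q' z.2))) ^ 2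
    _ ≤ ∫ z, (F z - v (q' z.1) (q' z.2)) ^ 2 :=
      integral_mono (hFB.sub (bm_step hq' fun i j => projIcc (0 : ℝ) 1 _ (v i j))).integrable_sq
        (hFB.sub (bm_step hq' v)).integrable_sq fun z => sub_projIcc_sq_le (h01 z) _
    _ = ∫ z, (G z - (S ×ˢ T).indicator (fun _ => c) z) ^ 2 := by simp only [hvG]
    _ ≤ (∫ z, G z ^ 2) - c ^ 2 := integral_sub_indicator_setIntegral_sq_le hG (hS.prod hT)
    _ ≤ (∫ z, G z ^ 2) - η ^ 2 :=
      sub_le_sub_left (sq_le_sq.2 ((abs_of_nonneg hη).trans_le hST.le)) _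

lemma integral_sub_half_sq_le {F : I × I → ℝ} (hF : Measurable F)
    (h01 : ∀ z, F z ∈ Icc (0 : ℝ) 1) : ∫ z, (F z - 1 / 2) ^ 2 ≤ 1 / 4 := by
  have hB : BM fun z => F z - 1 / 2 := ⟨hF.sub_const _, 1, fun z =>
    abs_le.2 ⟨by linarith [(h01 z).1], by linarith [(h01 z).2]⟩⟩
  calc ∫ z, (F z - 1 / 2) ^ 2
    _ ≤ ∫ _ : I × I, (1 / 4 : ℝ) := integral_mono hB.integrable_sq (integrable_const _)
      fun z => show (F z - 1 / 2) ^ 2 ≤ 1 / 4 by nlinarith [(h01 z).1, (h01 z).2]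
    _ = 1 / 4 := by simp

lemma exists_step_cutNorm_le_or_integral_sq_le {F : I × I → ℝ} (hF : Measurable F)
    (h01 : ∀ z, F z ∈ Icc (0 : ℝ) 1) {η : ℝ} (hη : 0 ≤ η) (l : ℕ) :
    ∃ q : I → Fin (4 ^ l), Measurable q ∧ ∃ w : Fin (4 ^ l) → Fin (4 ^ l) → I,
      supInt volume rect (fun z => F z - w (q z.1) (q z.2)) ≤ η ∨
        ∫ z, (F z - w (q z.1) (q z.2)) ^ 2 ≤ 1 / 4 - l * η ^ 2 := by
  induction l with
  | zero =>
    refine ⟨fun _ => 0, measurable_const, fun _ _ => ⟨1 / 2, by norm_num, by norm_num⟩, .inr ?_⟩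
    simpa using integral_sub_half_sq_le hF h01
  | succ l ih =>
    obtain ⟨q, hq, w, hw⟩ := ih
    by_cases hcut : supInt volume rect (fun z => F z - w (q z.1) (q z.2)) ≤ η
    · obtain ⟨q', hq', v, hv⟩ :=
        exists_refinement_add_indicator hq (fun i j => w i j) .univ .univ 0
      have hproj : ∀ z : I × I,
          projIcc (0 : ℝ) 1 zero_le_one (v (q' z.1) (q' z.2)) = w (q z.1) (q z.2) := fun z => by
        rw [hv, indicator_zero, add_zero, projIcc_val]
      refine ⟨q', hq', fun i j => projIcc 0 1 zero_le_one (v i j), .inl ?_⟩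
      simpa only [hproj] using hcut
    · have henergy := hw.resolve_left hcut
      obtain ⟨q', hq', w', hw'⟩ :=
        exists_refinement_integral_sq_le hF h01 hq w hη (not_le.1 hcut)
      refine ⟨q', hq', w', .inr (hw'.trans ?_)⟩
      push_cast
      linarith

lemma supInt_const_mul {Ω ι : Type*} [MeasurableSpace Ω] (μ : Measure Ω) (s : ι → Set Ω) {c : ℝ}
    (hc : 0 ≤ c) (F : Ω → ℝ) : supInt μ s (fun z => c * F z) = c * supInt μ s F := by
  simp only [supInt, integral_const_mul, abs_mul, abs_of_nonneg hc, Real.mul_iSup_of_nonneg hc]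

lemma supInt_rect_swap_le {G : I × I → ℝ} (hG : BM G) :
    supInt volume rect (fun z => G z.swap) ≤ supInt volume rect G :=
  supInt_comp_le rect hG Measure.measurePreserving_swap fun P =>
    ⟨P.swap, P.2.2.prod P.1.2, by rw [preimage_swap_prod]; rfl⟩

lemma supInt_rect_symmetrize_le {F V : I × I → ℝ} (hF : BM F) (hV : BM V)
    (hsymm : ∀ z, F z.swap = F z) :
    supInt volume rect (fun z => F z - (V z + V z.swap) / 2) ≤
      supInt volume rect fun z => F z - V z := by
  have hG := hF.sub hV
  have hhalf : ∀ z, F z - (V z + V z.swap) / 2 = 1 / 2 * (F z - V z + (F z.swap - V z.swap)) :=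
    fun z => by rw [hsymm]; ring
  simp only [hhalf]
  rw [supInt_const_mul _ _ (by norm_num)]
  linarith [supInt_add_le volume rect hG (hG.comp measurable_swap) fun _ => rfl,
    supInt_rect_swap_le hG]

lemma GraphonSignal.exists_step_cutNorm_le {r : ℝ} (u : GraphonSignal r) {η : ℝ} (hη : 0 ≤ η)
    {m : ℕ} (hm : 1 / 4 < m * η ^ 2) :
    ∃ q : I → Fin (4 ^ m), Measurable q ∧ ∃ w : Fin (4 ^ m) → Fin (4 ^ m) → I,
      (∀ i j, w i j = w j i) ∧
      supInt volume rect (fun z : I × I => u.W z.1 z.2 - w (q z.1) (q z.2)) ≤ η := by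
  obtain ⟨q, hq, w, hw⟩ := exists_step_cutNorm_le_or_integral_sq_le u.measurable_W
    (fun z => u.W_mem z.1 z.2) hη m
  have henergy : 0 ≤ ∫ z : I × I, (u.W z.1 z.2 - w (q z.1) (q z.2)) ^ 2 :=
    integral_nonneg fun z => sq_nonneg _
  have hcut := hw.resolve_right fun h => by linarith
  refine ⟨q, hq, fun i j => ⟨(w i j + w j i) / 2, ?_, ?_⟩, fun i j => ?_, ?_⟩
  · linarith [(w i j).2.1, (w j i).2.1]
  · linarith [(w i j).2.2, (w j i).2.2]
  · simp only [add_comm]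
  · exact (supInt_rect_symmetrize_le u.bmW (bm_step hq fun i j => w i j)
      fun z => u.symm_W _ _).trans hcut

/-! ### Covering numbers -/

lemma supInt_le_add_mul_measureReal {Ω ι : Type*} [MeasurableSpace Ω] {μ : Measure Ω}
    [IsProbabilityMeasure μ] (s : ι → Set Ω) {F : Ω → ℝ} {a b : ℝ} {B : Set Ω}
    (hB : MeasurableSet B) (ha : 0 ≤ a) (hgood : ∀ z ∉ B, |F z| ≤ a) (hb : ∀ z, |F z| ≤ b) :
    supInt μ s F ≤ a + b * μ.real B := by
  have hFG : ∀ z, |F z| ≤ a + B.indicator (fun _ => b) z := fun z => by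
    by_cases hz : z ∈ B
    · simpa only [indicator_of_mem hz] using (hb z).trans (le_add_of_nonneg_left ha)
    · simpa only [indicator_of_notMem hz, add_zero] using hgood z hz
  have hindicator : Integrable (B.indicator fun _ => b) μ := (integrable_const b).indicator hB
  have hG : Integrable (fun z => a + B.indicator (fun _ => b) z) μ :=
    (integrable_const a).add hindicator
  have hG0 : ∀ z, 0 ≤ a + B.indicator (fun _ => b) z := fun z => (abs_nonneg _).trans (hFG z)
  have hintegral : ∫ z, (a + B.indicator (fun _ => b) z) ∂μ = a + b * μ.real B := by
    rw [integral_add (integrable_const a) hindicator, integral_indicator_const b hB, integral_const,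
      probReal_univ, one_smul, smul_eq_mul, mul_comm]
  rw [← hintegral]
  refine Real.iSup_le (fun i => ?_) (integral_nonneg hG0)
  exact (norm_integral_le_of_norm_le (f := F) hG.integrableOn (.of_forall hFG)).trans
    (setIntegral_le_integral hG (.of_forall hG0))

lemma supInt_le_of_abs_le {Ω ι : Type*} [MeasurableSpace Ω] {μ : Measure Ω}
    [IsProbabilityMeasure μ] (s : ι → Set Ω) {F : Ω → ℝ} {b : ℝ} (hb : ∀ z, |F z| ≤ b) :
    supInt μ s F ≤ b := by
  have hb0 : 0 ≤ b := by
    obtain ⟨z⟩ := μ.nonempty_of_neZero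
    exact (abs_nonneg _).trans (hb z)
  simpa using supInt_le_add_mul_measureReal (μ := μ) s .empty hb0 (fun z _ => hb z) hb

lemma supInt_rect_sub_le {F G : I × I → ℝ} (hF : ∀ z, F z ∈ Icc (0 : ℝ) 1)
    (hG : ∀ z, G z ∈ Icc (0 : ℝ) 1) {B : Set I} (hB : MeasurableSet B) {δ : ℝ} (hδ : 0 ≤ δ)
    (hFG : ∀ z : I × I, z.1 ∉ B → z.2 ∉ B → |F z - G z| ≤ δ) :
    supInt volume rect (fun z => F z - G z) ≤ δ + 2 * volume.real B := by
  have hbad : volume.real (B ×ˢ univ ∪ univ ×ˢ B : Set (I × I)) ≤ 2 * volume.real B := by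
    refine (measureReal_union_le _ _).trans_eq ?_
    simp only [Measure.volume_eq_prod, measureReal_prod_prod, probReal_univ]
    ring
  have h := supInt_le_add_mul_measureReal (μ := volume) rect
    ((hB.prod .univ).union (.prod .univ hB)) hδ (F := fun z => F z - G z) (b := 1)
    (fun z hz => hFG z (fun h => hz (.inl ⟨h, mem_univ _⟩)) fun h => hz (.inr ⟨mem_univ _, h⟩))
    fun z => abs_le.2
      ⟨by linarith [(hF z).1, (hG z).2], by linarith [(hF z).2, (hG z).1]⟩
  linarith

lemma cutDist_le_one_add_two_mul {r : ℝ} (u v : GraphonSignal r) : cutDist u v ≤ 1 + 2 * r := by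
  refine (cutDist_le u v ConullBijection.refl).trans (add_le_add ?_ ?_)
  · refine supInt_le_of_abs_le rect fun z => abs_sub_le_of_nonneg_of_le ?_ ?_ ?_ ?_
    exacts [(u.W_mem _ _).1, (u.W_mem _ _).2, (v.W_mem _ _).1, (v.W_mem _ _).2]
  · refine supInt_le_of_abs_le _ fun x => (abs_sub _ _).trans ?_
    linarith [u.abs_f_le x, v.abs_f_le (ConullBijection.refl.toFun x)]

/-- Codes of discretized step graphon-signals: each of the `K` cells of the grid gets one of `n`
vertex types and one of `M` signal levels, and each unordered pair of types gets one of `M` kernel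
levels. -/
abbrev StepCode (n M K : ℕ) : Type := (Fin K → Fin n × Fin M) × (Sym2 (Fin n) → Fin M)

lemma fin_div_mem_Icc {M : ℕ} (j : Fin M) : (j : ℝ) / M ∈ Icc (0 : ℝ) 1 :=
  ⟨by positivity, div_le_one_of_le₀ (by exact_mod_cast j.2.le) (by positivity)⟩

/-- The step graphon-signal with a given code: the kernel level `j` stands for the value `j / M`
and the signal level `j` for the value `r (2j / M - 1)`. -/
def stepGraphonSignal {n M K : ℕ} [NeZero K] {r : ℝ} (hr : 0 ≤ r) (d : StepCode n M K) :
    GraphonSignal r where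
  W x y := (d.2 s((d.1 (gridIndex K x)).1, (d.1 (gridIndex K y)).1) : ℕ) / M
  f x := r * (2 * (((d.1 (gridIndex K x)).2 : ℕ) / M) - 1)
  measurable_W := (bm_step (measurable_gridIndex K) fun i j =>
    (d.2 s((d.1 i).1, (d.1 j).1) : ℕ) / M).1
  symm_W x y := by rw [Sym2.eq_swap]
  W_mem x y := fin_div_mem_Icc _
  measurable_f := (bm_comp_of_finite (measurable_gridIndex K) fun i =>
    r * (2 * (((d.1 i).2 : ℕ) / M) - 1)).1
  abs_f_le x := by
    obtain ⟨h0, h1⟩ := fin_div_mem_Icc (d.1 (gridIndex K x)).2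
    exact abs_le.2 ⟨by nlinarith, by nlinarith⟩

lemma card_stepCode_le (n K : ℕ) {M : ℕ} (hM : 0 < M) :
    Fintype.card (StepCode n M K) ≤ (n * M) ^ K * M ^ (n * n) := by
  have hSym2 : Fintype.card (Sym2 (Fin n)) ≤ n * n := by
    simpa using Fintype.card_le_of_surjective _ (Sym2.mk_surjective (α := Fin n))
  simp only [StepCode, Fintype.card_prod, Fintype.card_fun, Fintype.card_fin]
  gcongr

/-- The position of the signal in `[-r, r]`, rescaled to the unit interval. -/
def GraphonSignal.unitSignal {r : ℝ} (u : GraphonSignal r) (hr : 0 < r) (x : I) : I :=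
  ⟨(u.f x + r) / (2 * r), div_nonneg (by linarith [neg_le_of_abs_le (u.abs_f_le x)]) (by linarith),
    div_le_one_of_le₀ (by linarith [le_of_abs_le (u.abs_f_le x)]) (by linarith)⟩

lemma GraphonSignal.measurable_unitSignal {r : ℝ} (u : GraphonSignal r) (hr : 0 < r) :
    Measurable (u.unitSignal hr) :=
  ((u.measurable_f.add_const r).div_const _).subtype_mk

lemma exists_stepCode_apply_gridIndex_eq {n M K : ℕ} [NeZero M] [NeZero K] {q : I → Fin n}
    (hq : Measurable q) {t : I → I} (ht : Measurable t) (w : Sym2 (Fin n) → I) :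
    ∃ (d : StepCode n M K) (φ : ConullBijection) (B : Set I), MeasurableSet B ∧
      volume.real B ≤ n * M / K ∧
      (∀ x ∉ B, d.1 (gridIndex K (φ.toFun x)) = (q x, gridIndex M (t x))) ∧
      ∀ k, d.2 k = gridIndex M (w k) := by
  let e : Fin n × Fin M ≃ Fin (n * M) := finProdFinEquiv
  obtain ⟨φ, c, B, hB, hBvol, hBc⟩ := exists_conullBijection_grid
    ((measurable_of_finite e).comp (hq.prodMk ((measurable_gridIndex M).comp ht))) K
  refine ⟨(fun k => e.symm (c k), fun k => gridIndex M (w k)), φ, B, hB, ?_, fun x hx => ?_,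
    fun _ => rfl⟩
  · exact_mod_cast hBvol
  · exact (e.symm_apply_eq).2 (hBc x hx).symm

lemma exists_stepCode_cutDist_le {r : ℝ} (hr : 0 < r) {η : ℝ} {n M K : ℕ} [NeZero M] [NeZero K]
    (hK : (n * M : ℝ) / K ≤ 1 / M) (u : GraphonSignal r) {q : I → Fin n} (hq : Measurable q)
    {w : Fin n → Fin n → I} (hw : ∀ i j, w i j = w j i)
    (hcut : supInt volume rect (fun z : I × I => u.W z.1 z.2 - w (q z.1) (q z.2)) ≤ η) :
    ∃ d : StepCode n M K, cutDist u (stepGraphonSignal hr.le d) ≤ η + (3 + 4 * r) / M := by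
  obtain ⟨d, φ, B, hB, hBvol, hd₁, hd₂⟩ := exists_stepCode_apply_gridIndex_eq (M := M) (K := K) hq
    (u.measurable_unitSignal hr) (Sym2.lift ⟨w, hw⟩)
  have hBM := hBvol.trans hK
  set v := stepGraphonSignal hr.le d
  have hkernel : supInt volume rect
      (fun z : I × I => w (q z.1) (q z.2) - v.W (φ.toFun z.1) (φ.toFun z.2)) ≤
        1 / M + 2 * volume.real B := by
    refine supInt_rect_sub_le (fun z => (w _ _).2) (fun z => v.W_mem _ _) hB (by positivity)
      fun z h₁ h₂ => ?_
    have hv : v.W (φ.toFun z.1) (φ.toFun z.2) = (gridIndex M (w (q z.1) (q z.2)) : ℕ) / M := by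
      simp only [v, stepGraphonSignal, hd₁ _ h₁, hd₁ _ h₂, hd₂, Sym2.lift_mk]
    rw [hv]
    exact abs_sub_gridIndex_div_le M _
  have hsignal : signalCutNorm (fun x => u.f x - v.f (φ.toFun x)) ≤
      2 * r * (1 / M) + 2 * r * volume.real B := by
    refine supInt_le_add_mul_measureReal _ hB (by positivity) (fun x hx => ?_) fun x => ?_
    · have hv : u.f x - v.f (φ.toFun x) =
          2 * r * (u.unitSignal hr x - (gridIndex M (u.unitSignal hr x) : ℕ) / M) := by
        simp only [v, stepGraphonSignal, hd₁ _ hx, GraphonSignal.unitSignal]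
        field_simp
        ring
      rw [hv, abs_mul, abs_of_pos (by positivity)]
      gcongr
      exact abs_sub_gridIndex_div_le M _
    · linarith [abs_sub (u.f x) (v.f (φ.toFun x)), u.abs_f_le x, v.abs_f_le (φ.toFun x)]
  have htriangle := supInt_add_le volume rect (u.bmW.sub (bm_step hq fun i j => w i j))
    ((bm_step hq fun i j => w i j).sub (v.bmW.comp φ.prodMP.measurable))
    fun z => (sub_add_sub_cancel _ _ _).symm
  refine ⟨d, ?_⟩
  calc cutDist u v
    _ ≤ kernelCutNorm (fun x y => u.W x y - v.W (φ.toFun x) (φ.toFun y)) +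
        signalCutNorm (fun x => u.f x - v.f (φ.toFun x)) := cutDist_le u v φ
    _ ≤ (η + (1 / M + 2 * volume.real B)) + (2 * r * (1 / M) + 2 * r * volume.real B) :=
      add_le_add (htriangle.trans (add_le_add hcut hkernel)) hsignal
    _ ≤ (η + (1 / M + 2 * (1 / M))) + (2 * r * (1 / M) + 2 * r * (1 / M)) := by gcongr
    _ = η + (3 + 4 * r) / M := by ring

lemma card_stepCode_four_pow_le (m K : ℕ) {M : ℕ} (hM : 0 < M) :
    Fintype.card (StepCode (4 ^ m) M K) ≤ 2 ^ ((2 * m + M) * K + M * 16 ^ m) := by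
  have hM2 : M ≤ 2 ^ M := Nat.lt_two_pow_self.le
  calc Fintype.card (StepCode (4 ^ m) M K)
    _ ≤ (4 ^ m * M) ^ K * M ^ (4 ^ m * 4 ^ m) := card_stepCode_le _ _ hM
    _ ≤ (4 ^ m * 2 ^ M) ^ K * (2 ^ M) ^ (4 ^ m * 4 ^ m) := by gcongr
    _ = 2 ^ ((2 * m + M) * K + M * 16 ^ m) := by
      rw [show 4 = 2 ^ 2 from rfl, show 16 = 2 ^ 2 * 2 ^ 2 from rfl, mul_pow]
      simp only [← pow_mul, ← pow_add]
      congr 1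
      ring_nf

lemma stepCode_length_le (c m : ℕ) :
    (2 * m + c * m) * (4 ^ m * (c * m) * (c * m)) + c * m * 16 ^ m ≤
      ((2 + c) * c ^ 2 + c) * (m ^ 3 * 16 ^ m) :=
  calc (2 * m + c * m) * (4 ^ m * (c * m) * (c * m)) + c * m * 16 ^ m
    _ ≤ (2 * m + c * m) * (16 ^ m * (c * m) * (c * m)) + c * m ^ 3 * 16 ^ m := by
      gcongr
      · norm_num
      · exact Nat.le_self_pow (by norm_num) m
    _ = ((2 + c) * c ^ 2 + c) * (m ^ 3 * 16 ^ m) := by ring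

lemma eventually_mul_pow_mul_pow_le_rpow {a : ℝ} (ha : 2 < a) (Q : ℝ) :
    ∀ᶠ m : ℕ in Filter.atTop, Q * (m ^ 3 * 16 ^ m) ≤ (4 : ℝ) ^ (a * (m - 1)) := by
  have h16 : ‖(16 : ℝ)‖ < 4 ^ a := by
    rw [Real.norm_of_nonneg (by norm_num)]
    calc (16 : ℝ) = 4 ^ (2 : ℝ) := by norm_num
      _ < 4 ^ a := Real.rpow_lt_rpow_of_exponent_lt (by norm_num) ha
  have hlittle := (isLittleO_pow_const_mul_const_pow_const_pow_of_norm_lt 3 h16).const_mul_left Q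
  filter_upwards [hlittle.bound (show 0 < 1 / (4 : ℝ) ^ a by positivity)] with m hm
  have hrpow : (4 : ℝ) ^ (a * (m - 1)) = 1 / 4 ^ a * (4 ^ a) ^ m := by
    rw [mul_sub, mul_one, Real.rpow_sub (by norm_num), Real.rpow_mul (by norm_num),
      Real.rpow_natCast, one_div_mul_eq_div]
  rw [hrpow]
  exact (Real.le_norm_self _).trans (by
    rwa [Real.norm_of_nonneg (show 0 ≤ ((4 : ℝ) ^ a) ^ m by positivity)] at hm)

lemma four_rpow_le_ceil_sq (x : ℝ) : (4 : ℝ) ^ x ≤ ⌈(2 : ℝ) ^ x⌉₊ ^ 2 := by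
  rw [show (4 : ℝ) = 2 * 2 by norm_num, Real.mul_rpow zero_le_two zero_le_two, ← sq]
  gcongr
  exact Nat.le_ceil _

lemma exists_stepCode_parameters {a : ℝ} (ha : 2 < a) (ρ : ℝ) :
    ∃ ε₀ : ℝ, 0 < ε₀ ∧ ∀ ε : ℝ, 0 < ε → ε ≤ ε₀ → ∃ m M : ℕ, 0 < M ∧
      1 / 4 < m * (ε / 2) ^ 2 ∧ ρ / M < ε / 2 ∧
      Fintype.card (StepCode (4 ^ m) M (4 ^ m * M * M)) ≤ coverFormula a ε := by
  obtain ⟨c, hc⟩ := exists_nat_gt (max (2 * ρ) 0)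
  have hcρ : 2 * ρ < c := (le_max_left _ _).trans_lt hc
  have hc0 : 0 < c := by exact_mod_cast (le_max_right _ _).trans_lt hc
  obtain ⟨m₀, hm₀⟩ := Filter.eventually_atTop.1
    (eventually_mul_pow_mul_pow_le_rpow ha (((2 + c) * c ^ 2 + c : ℕ) : ℝ))
  refine ⟨1 / (m₀ + 1), by positivity, fun ε hε hεm₀ => ?_⟩
  have hm₀ε : (m₀ : ℝ) + 1 ≤ 1 / ε := by rwa [le_one_div (by positivity) hε]
  have hinv : 1 / ε ≤ 1 / ε ^ 2 := by
    have h1 : 1 ≤ 1 / ε := by linarith [m₀.cast_nonneg (α := ℝ)]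
    rw [← one_div_pow]
    exact le_self_pow₀ h1 two_ne_zero
  set m := ⌊1 / ε ^ 2⌋₊ + 1
  have hm_gt : 1 / ε ^ 2 < m := by
    rw [Nat.cast_succ]
    exact Nat.lt_floor_add_one _
  have hm_le : (m : ℝ) - 1 ≤ 1 / ε ^ 2 := by
    simpa [m] using Nat.floor_le (show 0 ≤ 1 / ε ^ 2 by positivity)
  have hm_ge : m₀ ≤ m := by
    have : (m₀ : ℝ) ≤ m := by linarith
    exact_mod_cast this
  refine ⟨m, c * m, by positivity, ?_, ?_, ?_⟩
  · rw [div_lt_iff₀ (by positivity)] at hm_gt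
    linarith
  · have hεm : 1 < m * ε := (div_lt_iff₀ hε).1 (hinv.trans_lt hm_gt)
    push_cast
    rw [div_lt_iff₀ (by positivity)]
    have : (c : ℝ) * 1 ≤ c * (m * ε) := by gcongr
    linarith
  · refine (card_stepCode_four_pow_le m _ (by positivity)).trans
      (Nat.pow_le_pow_right two_pos ((stepCode_length_le c m).trans ?_))
    have hexp : a * (m - 1) ≤ a / ε ^ 2 := by
      rw [← mul_one_div]
      gcongr
    have h := ((hm₀ m hm_ge).trans (Real.rpow_le_rpow_of_exponent_le (by norm_num) hexp)).trans
      (four_rpow_le_ceil_sq _)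
    exact_mod_cast h

lemma exists_ball_cover_of_card_le {Ω α : Type*} [PseudoMetricSpace Ω] [Fintype α] [Nonempty α]
    (f : α → Ω) {n : ℕ} (hn : Fintype.card α ≤ n) {ε : ℝ} (hf : ∀ x, ∃ d, dist x (f d) < ε) :
    ∃ z : Fin n → Ω, ⋃ i, Metric.ball (z i) ε = univ := by
  obtain ⟨g⟩ : Nonempty (α ↪ Fin n) := Function.Embedding.nonempty_of_card_le (by simpa using hn)
  refine ⟨f ∘ Function.invFun g, eq_univ_of_forall fun x => ?_⟩
  obtain ⟨d, hd⟩ := hf x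
  refine mem_iUnion.2 ⟨g d, ?_⟩
  rwa [Function.comp_apply, Function.leftInverse_invFun g.injective, Metric.mem_ball]

lemma exists_ball_cover {r : ℝ} (hr : 0 < r) {a : ℝ} (ha : 2 < a) :
    ∃ ε₀ : ℝ, 0 < ε₀ ∧ ∀ ε : ℝ, 0 < ε → ε ≤ ε₀ →
      ∃ z : Fin (coverFormula a ε) → GraphonSignalSpace r, ⋃ i, Metric.ball (z i) ε = univ := by
  obtain ⟨ε₀, hε₀, h⟩ := exists_stepCode_parameters ha (3 + 4 * r)
  refine ⟨ε₀, hε₀, fun ε hε hle => ?_⟩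
  obtain ⟨m, M, hM, hm, hρ, hcard⟩ := h ε hε hle
  have : NeZero M := ⟨hM.ne'⟩
  have : NeZero (4 ^ m) := ⟨by positivity⟩
  have : NeZero (4 ^ m * M * M) := ⟨by positivity⟩
  refine exists_ball_cover_of_card_le
    (fun d => SeparationQuotient.mk (stepGraphonSignal hr.le d)) hcard fun x => ?_
  obtain ⟨u, rfl⟩ := SeparationQuotient.surjective_mk x
  obtain ⟨q, hq, w, hw, hcut⟩ := u.exists_step_cutNorm_le (half_pos hε).le hm
  have hK : ((4 ^ m : ℕ) * M : ℝ) / (4 ^ m * M * M : ℕ) ≤ 1 / M := by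
    push_cast
    field_simp
    rfl
  obtain ⟨d, hd⟩ := exists_stepCode_cutDist_le hr hK u hq hw hcut
  refine ⟨d, ?_⟩
  rw [SeparationQuotient.dist_mk]
  exact hd.trans_lt (by linarith)

/-! ### The rate -/

lemma le_two_rpow_mul {a : ℝ} (ha : 2 ≤ a) {x : ℝ} (hx : 0 ≤ x) : x ≤ (2 : ℝ) ^ (a * x) := by
  have hlog : 1 ≤ Real.log 2 * a := by nlinarith [Real.log_two_gt_d9]
  calc x
    _ ≤ x + 1 := by linarith
    _ ≤ Real.exp x := Real.add_one_le_exp x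
    _ ≤ Real.exp (Real.log 2 * (a * x)) := by
      rw [← mul_assoc]
      exact Real.exp_le_exp.2 (le_mul_of_one_le_left hx hlog)
    _ = 2 ^ (a * x) := (Real.rpow_def_of_pos two_pos _).symm

lemma one_div_sq_sq_le_coverFormula {a : ℝ} (ha : 2 ≤ a) (e : ℝ) :
    (1 / e ^ 2) ^ 2 ≤ coverFormula a e := by
  have hk : 1 / e ^ 2 ≤ (⌈(2 : ℝ) ^ (a / e ^ 2)⌉₊ : ℝ) := by
    refine (le_two_rpow_mul ha (by positivity)).trans ?_
    rw [mul_one_div]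
    exact Nat.le_ceil _
  calc (1 / e ^ 2) ^ 2
    _ ≤ (⌈(2 : ℝ) ^ (a / e ^ 2)⌉₊ : ℝ) ^ 2 := by gcongr
    _ ≤ coverFormula a e := by exact_mod_cast Nat.lt_two_pow_self.le

lemma div_sq_le_coverFormula {a : ℝ} (ha : 2 ≤ a) {e : ℝ} (he : 0 < e) (he₈ : e ≤ 1 / 8) :
    64 / e ^ 2 ≤ coverFormula a e := by
  have h64 : 64 ≤ 1 / e ^ 2 := by
    rw [le_div_iff₀ (by positivity)]
    nlinarith
  refine le_trans ?_ (one_div_sq_sq_le_coverFormula ha e)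
  rw [← mul_one_div, sq (1 / e ^ 2)]
  gcongr

lemma three_le_kappa {a : ℝ} (ha : 2 ≤ a) {ε₁ : ℝ} (h₁ : 0 < ε₁) (h₁₈ : ε₁ ≤ 1 / 8) {ε : ℝ}
    (hε : 0 < ε) : (3 : ℝ) ≤ kappa a ε₁ ε := by
  have he : 0 < min ε ε₁ := lt_min hε h₁
  have he₈ : min ε ε₁ ≤ 1 / 8 := (min_le_right _ _).trans h₁₈
  refine le_trans ?_ (div_sq_le_coverFormula ha he he₈)
  rw [le_div_iff₀ (by positivity)]
  nlinarith

lemma sq_le_mul_sq_of_sq_mul_log_div_le {κ ε y : ℝ} (hκ : 3 ≤ κ) (hε : 0 < ε)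
    (h : κ ^ 2 * Real.log κ / ε ^ 2 ≤ y) : κ ^ 2 ≤ y * ε ^ 2 := by
  have hlog : 1 ≤ Real.log κ := by
    rw [Real.le_log_iff_exp_le (by linarith)]
    linarith [Real.exp_one_lt_d9]
  exact (le_mul_of_one_le_right (sq_nonneg κ) hlog).trans ((div_le_iff₀ (by positivity)).1 h)

lemma exists_xi_le (a ε₁ : ℝ) {y : ℝ} (hy : 0 < y) : {ε | 0 < ε ∧ xi a ε₁ ε ≤ y}.Nonempty := by
  have htendsto := tendsto_const_nhds
    (x := (coverFormula a ε₁ : ℝ) ^ 2 * Real.log (coverFormula a ε₁)) |>.div_atTop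
    (Filter.tendsto_pow_atTop (α := ℝ) two_ne_zero)
  obtain ⟨ε, hε, hε₁, hle⟩ := ((Filter.eventually_gt_atTop 0).and
    ((Filter.eventually_ge_atTop ε₁).and (htendsto.eventually_le_const hy))).exists
  exact ⟨ε, hε, by rwa [xi, kappa, min_eq_right hε₁]⟩

lemma xiInv_pos {a : ℝ} (ha : 2 ≤ a) {ε₁ : ℝ} (h₁ : 0 < ε₁) (h₁₈ : ε₁ ≤ 1 / 8) {y : ℝ}
    (hy : 0 < y) : 0 < xiInv a ε₁ y := by
  refine lt_of_lt_of_le (b := √(1 / y)) (by positivity)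
    (le_csInf (exists_xi_le a ε₁ hy) fun ε ⟨hε, hxi⟩ => ?_)
  have hκ := three_le_kappa ha h₁ h₁₈ hε
  refine Real.sqrt_le_iff.2 ⟨hε.le, ?_⟩
  rw [div_le_iff₀' hy]
  nlinarith [sq_le_mul_sq_of_sq_mul_log_div_le hκ hε hxi]

lemma exists_xi_le_lt_mul_xiInv {a : ℝ} (ha : 2 ≤ a) {ε₁ : ℝ} (h₁ : 0 < ε₁) (h₁₈ : ε₁ ≤ 1 / 8)
    {y : ℝ} (hy : 0 < y) {c : ℝ} (hc : 1 < c) :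
    ∃ ε : ℝ, 0 < ε ∧ xi a ε₁ ε ≤ y ∧ ε < c * xiInv a ε₁ y := by
  obtain ⟨ε, ⟨hε, hxi⟩, hlt⟩ := exists_lt_of_csInf_lt (exists_xi_le a ε₁ hy)
    (lt_mul_of_one_lt_left (xiInv_pos ha h₁ h₁₈ hy) hc)
  exact ⟨ε, hε, hxi, hlt⟩

/-- The deviation `t` at which the union bound `2 ^ n * exp (-2 N t²)` over `2 ^ n` Hoeffding
estimates for samples of size `N` equals the failure probability `p`. -/
def deviationRadius (n N p : ℝ) : ℝ := √((n * Real.log 2 + Real.log (1 / p)) / (2 * N))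

lemma two_pow_mul_exp_neg_deviationRadius (n : ℕ) {N p : ℝ} (hN : 0 < N) (hp : 0 < p)
    (hp₁ : p ≤ 1) : 2 ^ n * Real.exp (-(2 * N * deviationRadius n N p ^ 2)) = p := by
  have hlog : 0 ≤ Real.log (1 / p) := Real.log_nonneg (one_le_one_div hp hp₁)
  rw [deviationRadius, Real.sq_sqrt (by positivity), mul_div_cancel₀ _ (by positivity), neg_add,
    Real.exp_add, ← Real.log_pow, ← Real.log_inv, ← Real.log_inv, Real.exp_log (by positivity),
    Real.exp_log (by positivity)]
  field_simp

lemma mul_log_two_add_log_le {n p : ℝ} (hn : 1 ≤ n) (hp : 0 < p) (hp₁ : p ≤ 1) :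
    n * Real.log 2 + Real.log (1 / p) ≤ n * (1 + √(Real.log (2 / p))) ^ 2 := by
  have hlog₂ : Real.log 2 ≤ 1 := by linarith [Real.log_two_lt_d9]
  have hlog : Real.log (1 / p) ≤ Real.log (2 / p) := by
    gcongr
    norm_num
  set s := √(Real.log (2 / p))
  have hs : Real.log (2 / p) = s ^ 2 :=
    (Real.sq_sqrt ((Real.log_nonneg (one_le_one_div hp hp₁)).trans hlog)).symm
  calc n * Real.log 2 + Real.log (1 / p)
    _ ≤ n * 1 + n * s ^ 2 := by
      gcongr
      exact (hlog.trans hs.le).trans (le_mul_of_one_le_left (sq_nonneg s) hn)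
    _ ≤ n * 1 + n * s ^ 2 + n * (2 * s) := le_add_of_nonneg_right (by positivity)
    _ = n * (1 + s) ^ 2 := by ring

lemma two_mul_deviationRadius_le {κ C N ε e p : ℝ} (hκ : 0 < κ) (hκC : 1 ≤ κ * C) (hN : 0 < N)
    (hε : 0 ≤ ε) (he : 0 < e) (hp : 0 < p) (hp₁ : p ≤ 1) (hκN : κ ^ 2 ≤ N / (2 * C) * ε ^ 2)
    (hκe : 64 / e ^ 2 ≤ κ) :
    2 * deviationRadius (κ * C) N p ≤ ε * (1 + √(Real.log (2 / p))) * (e / 8) := by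
  have hC : 0 < C := pos_of_mul_pos_right (one_pos.trans_le hκC) hκ.le
  set s := √(Real.log (2 / p)) with hs
  have hκ₈ : 1 / κ ≤ (e / 8) ^ 2 := by
    rw [div_le_iff₀ (by positivity)] at hκe
    rw [div_le_iff₀ hκ]
    linarith
  rw [← le_div_iff₀' two_pos]
  refine Real.sqrt_le_iff.2 ⟨by positivity, ?_⟩
  calc (κ * C * Real.log 2 + Real.log (1 / p)) / (2 * N)
    _ ≤ κ * C * (1 + s) ^ 2 / (2 * N) := by
      gcongr
      exact mul_log_two_add_log_le hκC hp hp₁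
    _ = κ ^ 2 * (C * (1 + s) ^ 2 / (2 * N) * (1 / κ)) := by field_simp
    _ ≤ N / (2 * C) * ε ^ 2 * (C * (1 + s) ^ 2 / (2 * N) * (e / 8) ^ 2) := by gcongr
    _ = (ε * (1 + s) * (e / 8) / 2) ^ 2 := by field_simp

lemma oscillation_mul_le {L₁ L₂ D e : ℝ} (hL₁ : 0 ≤ L₁) (hL₂ : 0 ≤ L₂) (heL₁ : e ≤ L₁)
    (heD : e * D ≤ 1) : L₂ * (1 + L₁ * D) * e ≤ 2 * (L₁ * L₂) :=
  calc L₂ * (1 + L₁ * D) * e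
    _ = L₂ * (e + L₁ * (e * D)) := by ring
    _ ≤ L₂ * (L₁ + L₁ * 1) := by gcongr
    _ = 2 * (L₁ * L₂) := by ring

lemma error_le_rate {L R e t s ε δ : ℝ} (hL : 0 ≤ L) (hR : 0 ≤ R) (hs : 0 ≤ s) (hε : 0 ≤ ε)
    (heε : e ≤ ε) (hRe : R * e ≤ 2 * L) (ht : 2 * t ≤ ε * (1 + s) * (e / 8))
    (hεδ : ε ≤ 11 / 10 * δ) :
    2 * (L * e) + 2 * R * t ≤ δ * (2 * L + 1 / √2 * L * (1 + s)) := by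
  have hsqrt : (7 : ℝ) / 10 ≤ 1 / √2 := by
    rw [le_div_iff₀ (by positivity), ← le_div_iff₀' (by norm_num)]
    exact Real.sqrt_le_iff.2 ⟨by norm_num, by norm_num⟩
  have hδ : 0 ≤ δ := by linarith
  calc 2 * (L * e) + 2 * R * t
    _ = 2 * (L * e) + R * (2 * t) := by ring
    _ ≤ 2 * (L * ε) + R * (ε * (1 + s) * (e / 8)) := by gcongr
    _ = 2 * (L * ε) + ε * (1 + s) / 8 * (R * e) := by ring
    _ ≤ 2 * (L * ε) + ε * (1 + s) / 8 * (2 * L) := by gcongr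
    _ = ε * (L * (2 + (1 + s) / 4)) := by ring
    _ ≤ 11 / 10 * δ * (L * (2 + (1 + s) / 4)) := by gcongr
    _ = δ * (L * (11 / 10 * (2 + (1 + s) / 4))) := by ring
    _ ≤ δ * (L * (2 + 7 / 10 * (1 + s))) := by
      gcongr
      linarith
    _ = δ * (2 * L + 7 / 10 * L * (1 + s)) := by ring
    _ ≤ δ * (2 * L + 1 / √2 * L * (1 + s)) := by gcongr

/-! ### Generalization at the rate `ξ⁻¹` -/

lemma exists_event_loss_le_xiInv {Ω ι : Type*} [PseudoMetricSpace Ω] [MeasurableSpace Ω]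
    [OpensMeasurableSpace Ω] [Fintype ι] [DecidableEq ι] [MeasurableSpace ι]
    [DiscreteMeasurableSpace ι] {D : ℝ} (hD : ∀ x y : Ω, dist x y ≤ D) {a : ℝ} (ha : 2 ≤ a)
    {L₁ : ℝ≥0} (L₂ : ℝ≥0) {ε₁ : ℝ} (h₁ : 0 < ε₁) (h₁₈ : ε₁ ≤ 1 / 8) (h₁L₁ : ε₁ ≤ L₁)
    (h₁D : ε₁ * D ≤ 1)
    (hcover : ∀ ε : ℝ, 0 < ε → ε ≤ ε₁ →
      ∃ z : Fin (coverFormula a ε) → Ω, (⋃ i, Metric.ball (z i) ε) = univ)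
    {N : ℕ} (hN : 1 ≤ N) (ν : Measure Ω) [IsProbabilityMeasure ν] {cls : Ω → ι}
    (hcls : Measurable cls) {p : ℝ} (hp : 0 < p) :
    ∃ U : Set (Fin N → Ω), MeasurableSet U ∧ 1 - p ≤ (Measure.pi fun _ => ν).real U ∧
      ∀ X ∈ U, ∀ loss : (ι → ℝ) × (ι → ℝ) → ℝ, LipschitzWith L₂ loss →
      ∀ Υ : Ω → ι → ℝ, LipschitzWith L₁ Υ →
        |∫ x, loss (Υ x, Pi.single (cls x) 1) ∂ν -
          1 / N * ∑ i, loss (Υ (X i), Pi.single (cls (X i)) 1)| ≤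
          xiInv a ε₁ (N / (2 * Fintype.card ι)) *
            (2 * (L₁ * L₂) + 1 / √2 * (L₁ * L₂) * (1 + √(Real.log (2 / p)))) := by
  rcases lt_or_ge 1 p with hp₁ | hp₁
  · exact ⟨∅, .empty, by simpa using hp₁.le, fun X hX => hX.elim⟩
  have : NeZero N := ⟨by omega⟩
  have x₀ : Ω := (nonempty_of_isProbabilityMeasure ν).some
  have hD₀ : 0 ≤ D := dist_nonneg.trans (hD x₀ x₀)
  have hC : (1 : ℝ) ≤ Fintype.card ι := by exact_mod_cast Fintype.card_pos_iff.2 ⟨cls x₀⟩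
  have hN₀ : (0 : ℝ) < N := by positivity
  obtain ⟨ε, hε, hxi, hlt⟩ := exists_xi_le_lt_mul_xiInv ha h₁ h₁₈
    (show (0 : ℝ) < N / (2 * Fintype.card ι) by positivity) (show (1 : ℝ) < 11 / 10 by norm_num)
  have hκ₃ := three_le_kappa ha h₁ h₁₈ hε
  have he₁ : min ε ε₁ ≤ ε₁ := min_le_right _ _
  have he : 0 < min ε ε₁ := lt_min hε h₁
  have hradius := two_mul_deviationRadius_le (by positivity) (by nlinarith) hN₀ hε.le he hp hp₁
    (sq_le_mul_sq_of_sq_mul_log_div_le hκ₃ hε hxi) (div_sq_le_coverFormula ha he (he₁.trans h₁₈))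
  obtain ⟨z, hz⟩ := hcover _ he he₁
  obtain ⟨U, hU, hνU, hUX⟩ := exists_event_lipschitz_family (N := N) ν hz hcls
    (t := deviationRadius (kappa a ε₁ ε * Fintype.card ι) N p) (Real.sqrt_nonneg _)
  refine ⟨U, hU, ?_, fun X hX loss hloss Υ hΥ => ?_⟩
  · rwa [← Nat.cast_mul, Nat.card_eq_fintype_card, kappa,
      two_pow_mul_exp_neg_deviationRadius _ hN₀ hp hp₁] at hνU
  · refine (hUX X hX (fun i x => loss (Υ x, Pi.single i 1)) _ _
      (fun i => lipschitzWith_loss_const hloss hΥ _) (abs_loss_sub_loss_le hloss hΥ hD)).trans ?_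
    rw [NNReal.coe_mul, mul_comm (L₂ : ℝ)]
    have heD : min ε ε₁ * D ≤ 1 := (mul_le_mul_of_nonneg_right he₁ hD₀).trans h₁D
    exact error_le_rate (by positivity) (by positivity) (Real.sqrt_nonneg _) hε.le (min_le_left _ _)
      (oscillation_mul_le L₁.2 L₂.2 (he₁.trans h₁L₁) heD) hradius hlt.le

lemma GraphonSignalSpace.dist_le {r : ℝ} (x y : GraphonSignalSpace r) : dist x y ≤ 1 + 2 * r := by
  obtain ⟨u, rfl⟩ := SeparationQuotient.surjective_mk x
  obtain ⟨v, rfl⟩ := SeparationQuotient.surjective_mk y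
  exact cutDist_le_one_add_two_mul u v

lemma IsClassifier.exists_measurable_class {r : ℝ} {C : ℕ} {cl : GraphonSignalSpace r → Fin C → ℝ}
    (h : IsClassifier cl) :
    ∃ cls : GraphonSignalSpace r → Fin C, Measurable cls ∧ ∀ x, cl x = Pi.single (cls x) 1 := by
  obtain ⟨B, hmeas, hdisj, hunion, hcl⟩ := h
  choose cls hcls using fun x => mem_iUnion.1 (hunion ▸ mem_univ x)
  have hfiber (i : Fin C) : cls ⁻¹' {i} = B i := by
    ext x
    refine ⟨fun hx => hx ▸ hcls x, fun hx => ?_⟩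
    by_contra hne
    exact (hdisj _ _ hne).le_bot ⟨hcls x, hx⟩
  exact ⟨cls, measurable_to_countable' fun i => hfiber i ▸ hmeas i, fun x => hcl _ x (hcls x)⟩

lemma IsClassifier.one_le {r : ℝ} [Nonempty (GraphonSignalSpace r)] {C : ℕ}
    {cl : GraphonSignalSpace r → Fin C → ℝ} (h : IsClassifier cl) : 1 ≤ C := by
  obtain ⟨cls, -⟩ := h.exists_measurable_class
  exact (cls (Classical.arbitrary _)).pos

lemma xiInv_nonneg (a ε₁ y : ℝ) : 0 ≤ xiInv a ε₁ y :=
  Real.sInf_nonneg fun _ h => h.1.le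

end

end GraphonSignals

open GraphonSignals MeasureTheory in
theorem mainTheorem5_general (r : ℝ) (hr : 0 < r) (a : ℝ) (ha : 2 < a) :
    ∃ ε₀ : ℝ, 0 < ε₀ ∧
      (∀ ε : ℝ, 0 < ε → ε ≤ ε₀ →
        ∃ z : Fin (coverFormula a ε) → GraphonSignalSpace r,
          (⋃ i, Metric.ball (z i) ε) = Set.univ) ∧
      ∀ (C N : ℕ), 1 ≤ N →
      ∀ (ν : Measure (GraphonSignalSpace r)), IsProbabilityMeasure ν →
      ∀ (cl : GraphonSignalSpace r → Fin C → ℝ), IsClassifier cl →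
      ∀ (L₁ L₂ : NNReal), 0 < L₁ →
      ∀ p : ℝ, 0 < p →
      ∃ U : Set (Fin N → GraphonSignalSpace r), MeasurableSet U ∧
        1 - p ≤ (Measure.pi fun _ : Fin N => ν).real U ∧
        ∀ X ∈ U, ∀ loss : (Fin C → ℝ) × (Fin C → ℝ) → ℝ, LipschitzWith L₂ loss →
        ∀ Υ : GraphonSignalSpace r → Fin C → ℝ, LipschitzWith L₁ Υ →
          |statRisk ν loss cl Υ - empRisk loss cl Υ X| ≤
            xiInv a (ε₀ * min 1 (L₁ : ℝ)) ((N : ℝ) / (2 * C)) *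
              (2 * ((L₁ : ℝ) * L₂) +
                1 / √2 * ((L₁ : ℝ) * L₂) * (1 + √(Real.log (2 / p)))) := by
  obtain ⟨η, hη, hcover⟩ := exists_ball_cover hr ha
  obtain ⟨ε₀, h₀, h₀η, h₀₈, h₀D⟩ : ∃ ε₀ : ℝ, 0 < ε₀ ∧ ε₀ ≤ η ∧ ε₀ ≤ 1 / 8 ∧ ε₀ ≤ 1 / (1 + 2 * r) :=
    ⟨min η (min (1 / 8) (1 / (1 + 2 * r))), by positivity, by simp⟩
  have hcover₀ (ε : ℝ) (hε : 0 < ε) (hle : ε ≤ ε₀) := hcover ε hε (hle.trans h₀η)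
  refine ⟨ε₀, h₀, hcover₀, fun C N hN ν _ cl hcl L₁ L₂ hL₁ p hp => ?_⟩
  obtain ⟨cls, hcls, hcl_eq⟩ := hcl.exists_measurable_class
  have h₁ : ε₀ * min 1 (L₁ : ℝ) ≤ ε₀ := mul_le_of_le_one_right h₀.le (min_le_left _ _)
  have h₁L₁ : ε₀ * min 1 (L₁ : ℝ) ≤ L₁ := (mul_le_of_le_one_left (by positivity)
    (by linarith)).trans (min_le_right _ _)
  have h₁D : ε₀ * min 1 (L₁ : ℝ) * (1 + 2 * r) ≤ 1 :=
    (le_div_iff₀ (by positivity)).1 (h₁.trans h₀D)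
  simpa [statRisk, empRisk, hcl_eq] using
    exists_event_loss_le_xiInv GraphonSignalSpace.dist_le ha.le L₂ (by positivity) (h₁.trans h₀₈)
      h₁L₁ h₁D (fun ε hε hle => hcover₀ ε hε (hle.trans h₁)) hN ν hcls hp

open GraphonSignals in
theorem mainTheorem5 (r : ℝ) (hr : 0 < r) (a : ℝ) (ha : 2 < a) :
    ∃ ε₀ : ℝ, 0 < ε₀ ∧
      (∀ ε : ℝ, 0 < ε → ε ≤ ε₀ →
        ∃ z : Fin (GraphonSignals.coverFormula a ε) → GraphonSignals.GraphonSignalSpace r,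
          (⋃ i, Metric.ball (z i) ε) = Set.univ) ∧
      ∀ (C N : ℕ), 1 ≤ N →
      ∀ (ν : MeasureTheory.Measure (GraphonSignals.GraphonSignalSpace r)),
        MeasureTheory.IsProbabilityMeasure ν →
      ∀ (cl : GraphonSignals.GraphonSignalSpace r → Fin C → ℝ), GraphonSignals.IsClassifier cl →
      ∀ (L₁ L₂ : NNReal), 0 < L₁ →
      ∀ p : ℝ, 0 < p →
      ∃ U : Set (Fin N → GraphonSignals.GraphonSignalSpace r),
        MeasurableSet U ∧
        1 - C * p - 2 * ((C : ℝ) ^ 2 / N) ≤ (MeasureTheory.Measure.pi fun _ : Fin N => ν).real U ∧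
        ∀ X ∈ U, ∀ loss : (Fin C → ℝ) × (Fin C → ℝ) → ℝ, LipschitzWith L₂ loss →
        ∀ Υ : GraphonSignals.GraphonSignalSpace r → Fin C → ℝ, LipschitzWith L₁ Υ →
          |GraphonSignals.statRisk ν loss cl Υ - GraphonSignals.empRisk loss cl Υ X| ≤
            GraphonSignals.xiInv a (ε₀ * min 1 (L₁ : ℝ)) ((N : ℝ) / (2 * C)) *
              (2 * ((L₁ : ℝ) * L₂) +
                1 / √2 * ((L₁ : ℝ) * L₂ + |loss (0, 0)|) * (1 + √(Real.log (2 / p)))) := by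
  obtain ⟨ε₀, h₀, hcover, hgen⟩ := mainTheorem5_general r hr a ha
  refine ⟨ε₀, h₀, hcover, fun C N hN ν hν cl hcl L₁ L₂ hL₁ p hp => ?_⟩
  obtain ⟨U, hU, hνU, hUX⟩ := hgen C N hN ν hν cl hcl L₁ L₂ hL₁ p hp
  have := MeasureTheory.nonempty_of_isProbabilityMeasure ν
  have hCp : p ≤ C * p := le_mul_of_one_le_left hp.le (by exact_mod_cast hcl.one_le)
  refine ⟨U, hU, ?_, fun X hX loss hloss Υ hΥ => (hUX X hX loss hloss Υ hΥ).trans ?_⟩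
  · linarith [show 0 ≤ 2 * ((C : ℝ) ^ 2 / N) by positivity]
  · gcongr
    · exact xiInv_nonneg _ _ _
    · exact le_add_of_nonneg_right (abs_nonneg _)
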